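/- **Setting.** Let $d\ge 2$, $\langle x\rangle=\sqrt{1+|x|^2}$, $H=\mathbb 1_{(0,\infty)}$, $\hat f(\xi)=\int f(x)e^{-2\pi i x\cdot\xi}\,dx$, and let $D_a x=(a x_1,x_2,\dots,x_d)$. A *ridgelet system* consists of unit vectors $s_{j,\ell}\in\mathbb S^{d-1}$ ($j\in\mathbb N_0$, $0\le \ell\le L_j$), fixed orthogonal maps $R_{j,\ell}$ with $R_{j,\ell}s_{j,\ell}=e_1$, and real windows $\hat\psi_{j,\ell}$ with $\sum_{j,\ell}\hat\psi_{j,\ell}^2=1$, which for $j\ge1$ vanish outside $$P_{j,\ell}=\Big\{\xi:\ 2^{j-1}<|\xi|<2^{j+1},\ \big|\tfrac{\xi}{|\xi|}-s_{j,\ell}\big|<2^{-j+1}\Big\},$$ and for $j=0$ vanish outside $\{|\xi|<2\}$. Put $U_{j,\ell}=R_{j,\ell}^{-1}D_{2^{-j}}$ and, for $\lambda=(j,\ell,k)$ with $k\in\mathbb Z^d$, $\varphi_\lambda=2^{-j/2}\,\psi_{j,\ell}(\cdot-U_{j,\ell}k)$, and, for a transport direction $s\in\mathbb S^{d-1}$,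 $w_\lambda=1+2^j|s\cdot s_{j,\ell}|$. The system is *smooth up to order $N$* if the functions $\eta\mapsto\hat\psi_{j,\ell}(U_{j,\ell}^{-\top}\eta)$ are $C^N$ with derivatives up to order $N$ bounded independently of $j,\ell$. Let $h=\{x\cdot n=v\}$, $|n|=1$, be a hyperplane, whose points are written as $x=x'_h+vn$ with $x'_h\in n^\perp\cong\mathbb R^{d-1}$. For $g\in H^{1/2}(\mathbb R^d)$ we say that $g|_h=\gamma\in L^2(\mathbb R^{d-1})$ if $g\,\delta_h:=\lim_{\varepsilon\downarrow0}\frac1{2\varepsilon}\mathbb 1_{\{|x\cdot n-v|<\varepsilon\}}\,g$ (as a distribution) is the measure with density $\gamma$ on $h$. The *singular contribution* to the ridgelet coefficient $\langle\varphi_\lambda,H(x\cdot n-v)g\rangle$ is $$\alpha^{\mathrm s}_\lambda=\frac{-i}{2\pi}\int_{\mathbb R^d}\overline{\hat\varphi_\lambda(\xi)}\ \frac{\xi\cdot n}{|\xi|^2}\ \widehat{g\,\delta_h}(\xi)\,d\xi ,\qquad \widehat{g\,\delta_h}(\xi)=e^{-2\pi i v\,\xi\cdot n}\ \widehat{g|_h}(\xi'_h),$$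 where $\xi'_h\in n^\perp\cong\mathbb R^{d-1}$ is the orthogonal projection of $\xi$. Let $\kappa$ be a locally integrable function with $\kappa\ge\kappa_0>0$ almost everywhere, and let $u=\mathcal S[f]$ be the solution of $s\cdot\nabla u+\kappa u=f$ for $f=H(x\cdot n-v)g$, given by $u(R_s^{-1}x)=e^{-K(x)}\int_{-\infty}^{x_1}f(R_s^{-1}(r,x'))e^{K(r,x')}\,dr$ with $K(x_1,x')=\int_0^{x_1}\kappa(R_s^{-1}(r,x'))\,dr$ and an orthogonal map $R_s$, $R_ss=e_1$. If $u=u_0+H(x\cdot n-v)u_1$ with $u_0,u_1\in H^{1/2}(\mathbb R^d)$, let $\beta^{\mathrm s}_\lambda$ be defined as $\alpha^{\mathrm s}_\lambda$, with $u_1$ in place of $g$. **Proposition (localisation in space).** For all integers $d\ge2$ and $m\ge0$ there is an $N$ such that for every ridgelet system that is smooth up to order $N$ there is a constant $C$ with the following property. Let $h$ and $g\in H^{1/2}(\mathbb R^d)$ be as above. Let $\lambda=(j,\ell,k)$ be such that $\hat\psi_{j,\ell}$ vanishes outside $P_{j,\ell}$ (which holds for all $j\ge1$), let $\phi\in\mathbb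 R$ and a unit vector $b\perp e_1$ be such that $$R_{j,\ell}\,n=\cos\phi\;e_1-\sin\phi\;b$$ (such $\phi$ and $b$ always exist, and $\cos\phi=s_{j,\ell}\cdot n$; if $R_{j,\ell}$ is chosen so that $R_{j,\ell}n=(\cos\phi,-\sin\phi,0,\dots,0)^\top$, one may take $b=e_2$), and set $$t=k-vU_{j,\ell}^{-1}n,\qquad t_1=t\cdot e_1,\quad t_2=t\cdot b,\quad t''=t-t_1e_1-t_2b,\qquad a=\sqrt{2^{2j}\sin^2\phi+\cos^2\phi},$$ $$\rho_1=\frac1a\big(\cos\phi\,t_1-2^j\sin\phi\,t_2\big),\qquad \rho_2=\frac1{a^2}\big(2^j\sin\phi\,t_1+\cos\phi\,t_2\big).$$ * If $g|_h\in L^2(\mathbb R^{d-1})$ exists and $|g|_h(x'_h)|\le A\langle x'_h\rangle^{-2m}$ almost everywhere, then $$|\alpha^{\mathrm s}_\lambda|\le C A\,\frac1a\,\frac{2^{-j/2}}{(|t''|^2+\rho_1^2+\rho_2^2+1)^m}.$$ * If $u=\mathcal S[H(x\cdot n-v)g]=u_0+H(x\cdot n-v)u_1$ as above, $u_1|_h\in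 L^2(\mathbb R^{d-1})$ exists and $|u_1|_h(x'_h)|\le A\langle x'_h\rangle^{-2m}$ almost everywhere, then $$|w_\lambda\beta^{\mathrm s}_\lambda|\le C A\,\frac1a\,\frac{2^{j/2}}{(|t''|^2+\rho_1^2+\rho_2^2+1)^m}.$$ -/

import Mathlib

open MeasureTheory Filter Topology
open scoped FourierTransform SchwartzMap RealInnerProductSpace ContDiff

noncomputable section

namespace Ridgelet

/-- Euclidean space `ℝ^d`. The coordinates are numbered from `0`, so `x 0` is the usual
first coordinate `x₁`. -/
abbrev Eucl (d : ℕ) : Type := EuclideanSpace ℝ (Fin d)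

/-- The first canonical unit vector. -/
def e1 (d : ℕ) [NeZero d] : Eucl d := EuclideanSpace.single 0 1

/-- The regularised absolute value `⟨x⟩ = √(1 + |x|²)`. -/
def bracket {d : ℕ} (x : Eucl d) : ℝ := √(1 + ‖x‖ ^ 2)

/-- The Heaviside function, the indicator function of `(0, ∞)`. -/
def heaviside (y : ℝ) : ℝ := Set.indicator (Set.Ioi 0) 1 y

/-- `x` with its first coordinate replaced by `r`. -/
def setFirst {d : ℕ} [NeZero d] (x : Eucl d) (r : ℝ) : Eucl d :=
  WithLp.toLp 2 (fun i => if i = 0 then r else x i)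

/-- The dilation `D_a` of the first coordinate, `D_a x = (a x₁, x₂, …, x_d)`. -/
def dilate {d : ℕ} [NeZero d] (a : ℝ) (x : Eucl d) : Eucl d := setFirst x (a * x 0)

/-- An integer vector, regarded as an element of `ℝ^d`. -/
def latticePt {d : ℕ} (k : Fin d → ℤ) : Eucl d := WithLp.toLp 2 (fun i => (k i : ℝ))

/-! ### The ridgelet frame -/

/-- The polar rectangle with direction `σ` at scale `j`. -/
def polarRect {d : ℕ} (σ : Eucl d) (j : ℕ) : Set (Eucl d) :=
  {ξ | (2 : ℝ) ^ ((j : ℝ) - 1) < ‖ξ‖ ∧ ‖ξ‖ < (2 : ℝ) ^ ((j : ℝ) + 1) ∧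
    ‖(‖ξ‖⁻¹ : ℝ) • ξ - σ‖ < (2 : ℝ) ^ (1 - (j : ℝ))}

/-- The data from which a ridgelet frame is constructed: directions `s_{j,ℓ}` on the sphere,
rotations taking them to `e₁` (fixed, but otherwise arbitrary), and windows `ψ̂_{j,ℓ}` whose squares
form a partition of unity in frequency and which are supported on polar rectangles. Since
polar rectangles do not contain the origin, the windows at the scale `j = 0` have to
cover the low frequencies. -/
structure System (d : ℕ) [NeZero d] where
  /-- there are `L j + 1` directions at scale `j` -/
  L : ℕ → ℕ
  /-- the directions `s_{j,ℓ}` -/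
  dir : (j : ℕ) → Fin (L j + 1) → Eucl d
  norm_dir : ∀ j l, ‖dir j l‖ = 1
  /-- the rotations `R_{j,ℓ}` -/
  rot : (j : ℕ) → Fin (L j + 1) → (Eucl d ≃ₗᵢ[ℝ] Eucl d)
  rot_dir : ∀ j l, rot j l (dir j l) = e1 d
  /-- the windows `ψ̂_{j,ℓ}` -/
  win : (j : ℕ) → Fin (L j + 1) → Eucl d → ℝ
  partition : ∀ ξ, HasSum (fun j => ∑ l, win j l ξ ^ 2) 1
  support_low : ∀ l, Function.support (win 0 l) ⊆ Metric.ball 0 2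
  support_high : ∀ j l, 1 ≤ j → Function.support (win j l) ⊆ polarRect (dir j l) j

namespace System

variable {d : ℕ} [NeZero d] (Φ : System d)

/-- `U_{j,ℓ} = R_{j,ℓ}⁻¹ D_{2^{-j}}`. -/
def U (j : ℕ) (l : Fin (Φ.L j + 1)) (x : Eucl d) : Eucl d :=
  (Φ.rot j l).symm (dilate ((2 : ℝ) ^ (-(j : ℝ))) x)

/-- `U_{j,ℓ}⁻¹ = D_{2^j} R_{j,ℓ}`. -/
def Uinv (j : ℕ) (l : Fin (Φ.L j + 1)) (x : Eucl d) : Eucl d :=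
  dilate ((2 : ℝ) ^ j) (Φ.rot j l x)

/-- `U_{j,ℓ}^{-⊤} = R_{j,ℓ}⁻¹ D_{2^j}`. -/
def UinvT (j : ℕ) (l : Fin (Φ.L j + 1)) (η : Eucl d) : Eucl d :=
  (Φ.rot j l).symm (dilate ((2 : ℝ) ^ j) η)

/-- The transformed window `η ↦ ψ̂_{j,ℓ}(U_{j,ℓ}^{-⊤} η)`. -/
def normWin (j : ℕ) (l : Fin (Φ.L j + 1)) (η : Eucl d) : ℝ := Φ.win j l (Φ.UinvT j l η)

/-- The transformed windows are `C^N`, with bounds on the derivatives up to order `N` that are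
independent of `j` and `ℓ`. -/
def SmoothUpTo (N : ℕ) : Prop :=
  (∀ j l, ContDiff ℝ N (Φ.normWin j l)) ∧
  ∃ B : ℝ, ∀ i ≤ N, ∀ j l η, ‖iteratedFDeriv ℝ i (Φ.normWin j l) η‖ ≤ B

/-- The function `ψ_{j,ℓ}`, whose Fourier transform is the window `ψ̂_{j,ℓ}`. -/
def psi (j : ℕ) (l : Fin (Φ.L j + 1)) : Eucl d → ℂ := 𝓕⁻ (fun ξ => (Φ.win j l ξ : ℂ))

/-- The ridgelet `φ_{j,ℓ,k} = 2^{-j/2} ψ_{j,ℓ}(· - U_{j,ℓ} k)`. -/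
def ridgelet (j : ℕ) (l : Fin (Φ.L j + 1)) (k : Fin d → ℤ) (x : Eucl d) : ℂ :=
  ((2 : ℝ) ^ (-(j : ℝ) / 2) : ℝ) * Φ.psi j l (x - Φ.U j l (latticePt k))

/-- The weight `w_λ = 1 + 2^j |s · s_{j,ℓ}|` for the transport direction `s`. -/
def weight (s : Eucl d) (j : ℕ) (l : Fin (Φ.L j + 1)) : ℝ := 1 + 2 ^ j * |⟪s, Φ.dir j l⟫|

end System

/-! ### Hyperplanes, traces and the singular contribution to the coefficients -/

/-- A hyperplane `h = {x | x · n = v}` with unit normal `n`, together with an isometry `J` of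
`ℝ^{d-1}` onto the orthogonal complement of `n`, by which `x' ∈ ℝ^{d-1}` is identified with the
point `J x' + v n` of `h`. -/
structure Hyperplane (d : ℕ) where
  /-- the unit normal -/
  n : Eucl d
  norm_n : ‖n‖ = 1
  /-- the offset -/
  v : ℝ
  /-- the identification of `ℝ^{d-1}` with the orthogonal complement of `n` -/
  J : Eucl (d - 1) →ₗᵢ[ℝ] Eucl d
  orth : ∀ y, ⟪J y, n⟫ = 0

namespace Hyperplane

variable {d : ℕ} (h : Hyperplane d)

/-- The cut-off function `x ↦ H(x · n - v) g(x)`. -/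
def cut (g : Eucl d → ℂ) (x : Eucl d) : ℂ := (heaviside (⟪x, h.n⟫ - h.v) : ℂ) * g x

/-- `γ ∈ L²(ℝ^{d-1})` is the restriction of `g` to the hyperplane `h`: the product `g δ_h`, defined
as the limit of `(2ε)⁻¹ 1_{|x · n - v| < ε} g` in the sense of distributions as `ε → 0`, is the
measure with density `γ` on `h`. (For `g ∈ H^t` with `t > 1/2`, this is the usual trace, and for
continuous `g` it is the pointwise restriction; on `H^{1/2}`, where there is no trace operator,
it is a property of `g`.) -/
def HasTrace (g : Eucl d → ℂ) (γ : Lp ℂ 2 (volume : Measure (Eucl (d - 1)))) : Prop :=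
  ∀ χ : Eucl d → ℂ, ContDiff ℝ ∞ χ → HasCompactSupport χ →
    Tendsto (fun ε : ℝ => ((2 * ε)⁻¹ : ℂ) * ∫ x in {x | |⟪x, h.n⟫ - h.v| < ε}, χ x * g x)
      (𝓝[>] 0) (𝓝 (∫ y, χ (h.J y + h.v • h.n) * γ y))

/-- The Fourier transform on `ℝ^d` of the distribution `γ δ_h`, where `γ ∈ L²(ℝ^{d-1})`:
`ξ ↦ e^{-2πi v ξ·n} γ̂(ξ'_h)`, where `ξ'_h = J^⊤ ξ ∈ ℝ^{d-1}` corresponds to the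
orthogonal projection of `ξ` along `n`, and `γ̂` is the Fourier transform on `L²(ℝ^{d-1})`. -/
def layerFourier (γ : Lp ℂ 2 (volume : Measure (Eucl (d - 1)))) (ξ : Eucl d) : ℂ :=
  Complex.exp (-(2 * Real.pi * (h.v * ⟪ξ, h.n⟫) : ℝ) * Complex.I) *
    (𝓕 γ : Lp ℂ 2 (volume : Measure (Eucl (d - 1))))
      (ContinuousLinearMap.adjoint h.J.toContinuousLinearMap ξ)

/-- The part of the Fourier transform of `H(x · n - v) g(x)` that comes from the cut-off, where
`γ` is the restriction of `g` to `h`: since `∇ (H g) = H ∇g + (g δ_h) n`, it is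
`- i (ξ · n) / (2π |ξ|²)` times the Fourier transform of `g δ_h`. -/
def singularFourier (γ : Lp ℂ 2 (volume : Measure (Eucl (d - 1)))) (ξ : Eucl d) : ℂ :=
  -(Complex.I / (2 * Real.pi)) * ((⟪ξ, h.n⟫ / ‖ξ‖ ^ 2 : ℝ) : ℂ) * h.layerFourier γ ξ

end Hyperplane

/-- The singular contribution to the ridgelet coefficient with index `λ = (j, ℓ, k)` of
`H(x · n - v) g(x)`, where `γ` is the restriction of `g` to the hyperplane. -/
def System.singularCoeff {d : ℕ} [NeZero d] (Φ : System d) (h : Hyperplane d)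
    (γ : Lp ℂ 2 (volume : Measure (Eucl (d - 1))))
    (j : ℕ) (l : Fin (Φ.L j + 1)) (k : Fin d → ℤ) : ℂ :=
  ∫ ξ, (starRingEnd ℂ) (𝓕 (Φ.ridgelet j l k) ξ) * h.singularFourier γ ξ

/-! ### The solution operator of the advection equation `s · ∇u + κ u = f` -/

/-- `K(x₁, x') = ∫₀^{x₁} κ(R⁻¹(r, x')) dr`, where `R` is a rotation taking `s` to `e₁`. -/
def absorptionPrimitive {d : ℕ} [NeZero d] (κ : Eucl d → ℝ) (R : Eucl d ≃ₗᵢ[ℝ] Eucl d)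
    (x : Eucl d) : ℝ :=
  ∫ r in (0 : ℝ)..(x 0), κ (R.symm (setFirst x r))

/-- The solution in rotated coordinates,
`y(x₁, x') = e^{-K(x₁, x')} ∫_{-∞}^{x₁} f(R⁻¹(r, x')) e^{K(r, x')} dr`. -/
def rotatedSolution {d : ℕ} [NeZero d] (κ : Eucl d → ℝ) (R : Eucl d ≃ₗᵢ[ℝ] Eucl d)
    (f : Eucl d → ℂ) (x : Eucl d) : ℂ :=
  (Real.exp (-absorptionPrimitive κ R x) : ℂ) *
    ∫ r in Set.Iic (x 0), f (R.symm (setFirst x r)) *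
      (Real.exp (absorptionPrimitive κ R (setFirst x r)) : ℂ)

/-- The solution `𝒮[f](x) = y(R x)` of `s · ∇u + κ u = f`. -/
def solution {d : ℕ} [NeZero d] (κ : Eucl d → ℝ) (R : Eucl d ≃ₗᵢ[ℝ] Eucl d)
    (f : Eucl d → ℂ) (x : Eucl d) : ℂ :=
  rotatedSolution κ R f (R x)

/-! ### The parameters of the localisation -/

/-- `a = √(2^{2j} sin² φ + cos² φ)`. -/
def aniso (j : ℕ) (φ : ℝ) : ℝ := √(2 ^ (2 * j) * Real.sin φ ^ 2 + Real.cos φ ^ 2)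

/-- `ρ₁ = (cos φ t₁ - 2^j sin φ t₂) / a`. -/
def rho1 (j : ℕ) (φ t₁ t₂ : ℝ) : ℝ :=
  1 / aniso j φ * (Real.cos φ * t₁ - 2 ^ j * Real.sin φ * t₂)

/-- `ρ₂ = (2^j sin φ t₁ + cos φ t₂) / a²`. -/
def rho2 (j : ℕ) (φ t₁ t₂ : ℝ) : ℝ :=
  1 / aniso j φ ^ 2 * (2 ^ j * Real.sin φ * t₁ + Real.cos φ * t₂)

/-- The shifted translation `t(k) = k - v U_{j,ℓ}⁻¹ n`. -/
def System.shift {d : ℕ} [NeZero d] (Φ : System d) (h : Hyperplane d)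
    (j : ℕ) (l : Fin (Φ.L j + 1)) (k : Fin d → ℤ) : Eucl d :=
  latticePt k - h.v • Φ.Uinv j l h.n

/-- The bound `a⁻¹ q (|t''|² + ρ₁² + ρ₂² + 1)^{-m}`, where `t₁ = t · e₁`, `t₂ = t · b`, and
`t''` is the component of `t` orthogonal to the orthonormal vectors `e₁` and `b`. -/
def locBound {d : ℕ} [NeZero d] (m j : ℕ) (φ : ℝ) (b t : Eucl d) (q : ℝ) : ℝ :=
  1 / aniso j φ * (q /
    (‖t - t 0 • e1 d - ⟪b, t⟫ • b‖ ^ 2 + rho1 j φ (t 0) ⟪b, t⟫ ^ 2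
      + rho2 j φ (t 0) ⟪b, t⟫ ^ 2 + 1) ^ m)

/-- `φ` is the angle from `s_{j,ℓ}` to `n` in the following sense: the rotation `R_{j,ℓ}`, which
takes `s_{j,ℓ}` to `e₁`, takes `n` to `cos φ e₁ - sin φ b` with a unit vector `b ⊥ e₁`. (Such `φ`
and `b` always exist if `d ≥ 2`, and `cos φ = s_{j,ℓ} · n`.) -/
def System.IsAngle {d : ℕ} [NeZero d] (Φ : System d) (n : Eucl d)
    (j : ℕ) (l : Fin (Φ.L j + 1)) (φ : ℝ) (b : Eucl d) : Prop :=
  ‖b‖ = 1 ∧ ⟪e1 d, b⟫ = 0 ∧ Φ.rot j l n = Real.cos φ • e1 d - Real.sin φ • b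

end Ridgelet

end

/-!
Parseval's identity, in coordinates adapted to the hyperplane
(`Hyperplane.integral_mul_fourier_layer`), turns the singular contribution into the integral of the
trace `γ` against a kernel on the hyperplane. The change of variables `ξ = U^{-⊤} η` shows that
this kernel is, up to a numerical factor, `2^{-j/2}` times the Fourier transform, taken at
`U⁻¹ J y - t`, of a symbol in `η`: the Jacobian `2^j` cancels the factor
`2^{-j}` by which `(ξ · n) / |ξ|²` is smaller than a function that is smooth in `η` uniformly in
the scale (`System.win_mul_symbol`, `exists_bound_mul_inner`). The symbol is supported in a fixed ball
(`System.support_normWin_subset`), so the kernel decays rapidly in `|U⁻¹ J y - t|`, uniformly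
in all parameters (`exists_norm_fourier_le`).

The rest is geometry. The points `U⁻¹ J y - t` form a hyperplane at distance `|ρ₁|` from the
origin, and `y ↦ U⁻¹ J y` stretches one direction by the factor `a ≥ 1`. Hence Peetre's inequality
moves the decay of `γ` to the factor `(|t''|² + ρ₁² + ρ₂² + 1)^{-m}`
(`exists_stretch_hyperplane`), and integration of the remaining decay of the kernel gives the
factor `1/a`. The weighted bound follows since `w_λ ≤ 2 · 2^j`.
-/

noncomputable section

namespace Ridgelet

/-! ### Stretching along one direction -/

section Stretch

variable {E : Type*} [NormedAddCommGroup E] [InnerProductSpace ℝ E]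

/-- The linear map that multiplies the component along `c` by `a` (for a unit vector `c`) and fixes
the orthogonal complement of `c`. -/
def stretch (a : ℝ) (c : E) : E →ₗ[ℝ] E :=
  LinearMap.transvection ((a - 1) • (innerSL ℝ c : E →ₗ[ℝ] ℝ)) c

lemma stretch_apply (a : ℝ) (c x : E) : stretch a c x = x + ((a - 1) * ⟪c, x⟫) • c := by
  simp [stretch, LinearMap.transvection.apply]

lemma inner_stretch_comm (a : ℝ) (c x y : E) : ⟪stretch a c x, y⟫ = ⟪x, stretch a c y⟫ := by
  simp only [stretch_apply, inner_add_left, inner_add_right, inner_smul_left, inner_smul_right,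
    real_inner_comm c x, RCLike.conj_to_real]
  ring

lemma stretch_stretch {a a' : ℝ} {c : E} (hc : ‖c‖ = 1) (x : E) :
    stretch a c (stretch a' c x) = stretch (a * a') c x := by
  have h : ⟪c, c⟫ = 1 := by rw [real_inner_self_eq_norm_sq, hc]; norm_num
  simp only [stretch_apply, inner_add_right, inner_smul_right, h, add_assoc, ← add_smul]
  congr 2
  ring

@[simp] lemma stretch_one (c x : E) : stretch 1 c x = x := by simp [stretch_apply]

variable [FiniteDimensional ℝ E]

lemma det_stretch {a : ℝ} {c : E} (hc : ‖c‖ = 1) : LinearMap.det (stretch a c) = a := by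
  simp [stretch, hc]

variable [MeasurableSpace E] [BorelSpace E]

lemma measurableEmbedding_stretch {a : ℝ} {c : E} (ha : a ≠ 0) (hc : ‖c‖ = 1) :
    MeasurableEmbedding (stretch a c) :=
  ((stretch a c).equivOfDetNeZero
    (by rwa [det_stretch hc])).toContinuousLinearEquiv.toHomeomorph.measurableEmbedding

lemma map_stretch {a : ℝ} {c : E} (ha : a ≠ 0) (hc : ‖c‖ = 1) :
    Measure.map (stretch a c) (volume : Measure E) = ENNReal.ofReal |a⁻¹| • volume := by
  have := Measure.map_linearMap_addHaar_eq_smul_addHaar (volume : Measure E)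
    (f := stretch a c) (by rwa [det_stretch hc])
  rwa [det_stretch hc] at this

lemma integral_comp_stretch {F : Type*} [NormedAddCommGroup F] [NormedSpace ℝ F]
    {a : ℝ} {c : E} (ha : a ≠ 0) (hc : ‖c‖ = 1) (f : E → F) :
    ∫ x, f (stretch a c x) = |a⁻¹| • ∫ x, f x := by
  rw [← (measurableEmbedding_stretch ha hc).integral_map, map_stretch ha hc, integral_smul_measure]
  simp

lemma integrable_comp_stretch {F : Type*} [NormedAddCommGroup F]
    {a : ℝ} {c : E} (ha : a ≠ 0) (hc : ‖c‖ = 1) {f : E → F} (hf : Integrable f) :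
    Integrable (fun x => f (stretch a c x)) := by
  have := (measurableEmbedding_stretch ha hc).integrable_map_iff (g := f) (μ := volume)
  rw [map_stretch ha hc] at this
  exact this.1 (hf.smul_measure ENNReal.ofReal_ne_top)

end Stretch

/-! ### Decay of Fourier transforms -/

section Decay

variable {E : Type*} [NormedAddCommGroup E] [InnerProductSpace ℝ E] [FiniteDimensional ℝ E]
  [MeasurableSpace E] [BorelSpace E]

lemma integrable_inv_one_add_norm_sq_pow {n : ℕ} (hn : Module.finrank ℝ E < 2 * n) :
    Integrable (fun x : E => ((1 + ‖x‖ ^ 2) ^ n)⁻¹) := by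
  have := integrable_rpow_neg_one_add_norm_sq (E := E) (μ := volume) (r := 2 * n)
    (by exact_mod_cast hn)
  refine this.congr (Eventually.of_forall fun x => ?_)
  have : -(2 * (n : ℝ)) / 2 = -n := by ring
  simp only [this]
  rw [Real.rpow_neg (by positivity), Real.rpow_natCast]

variable (E) in
/-- The Fourier transform of a compactly supported function with `2n` bounded derivatives decays
like `(1 + |w|²)⁻ⁿ`, with a constant that depends only on the size of the support and on the bound
for the derivatives. -/
lemma exists_norm_fourier_le (r : ℝ) (n : ℕ) :
    ∃ C : ℝ, 0 ≤ C ∧ ∀ (f : E → ℂ) (B : ℝ), ContDiff ℝ (2 * n : ℕ) f →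
      Function.support f ⊆ Metric.closedBall 0 r →
      (∀ i ≤ 2 * n, ∀ x, ‖iteratedFDeriv ℝ i f x‖ ≤ B) →
      ∀ w, ‖𝓕 f w‖ ≤ C * B * ((1 + ‖w‖ ^ 2) ^ n)⁻¹ := by
  set V : ℝ := (volume : Measure E).real (Metric.closedBall 0 r)
  refine ⟨2 ^ n * (V + 2 ^ (2 * n) * ((2 * n + 1) * V)), by positivity, ?_⟩
  intro f B hf hs hB w
  have hcs : HasCompactSupport f := HasCompactSupport.intro (isCompact_closedBall 0 r)
    fun x hx => by_contra fun h => hx (hs h)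
  have hts : tsupport f ⊆ Metric.closedBall 0 r := closure_minimal hs Metric.isClosed_closedBall
  have hint : ∀ i : ℕ, i ≤ 2 * n → Integrable (fun v => ‖iteratedFDeriv ℝ i f v‖) := by
    intro i hi
    exact ((hf.continuous_iteratedFDeriv (by exact_mod_cast hi)).integrable_of_hasCompactSupport
      (hcs.iteratedFDeriv i)).norm
  have hI : ∀ i : ℕ, i ≤ 2 * n → ∫ v, ‖iteratedFDeriv ℝ i f v‖ ≤ V * B := by
    intro i hi
    rw [← setIntegral_eq_integral_of_forall_compl_eq_zero (s := Metric.closedBall 0 r)]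
    · calc _ ≤ ‖∫ v in Metric.closedBall 0 r, ‖iteratedFDeriv ℝ i f v‖‖ := le_abs_self _
        _ ≤ B * V := norm_setIntegral_le_of_norm_le_const measure_closedBall_lt_top
            (fun x _ => by simpa using hB i hi x)
        _ = _ := mul_comm _ _
    · intro x hx
      rw [norm_eq_zero]
      by_contra h
      exact hx (hts (support_iteratedFDeriv_subset i h))
  have key := Real.pow_mul_norm_iteratedFDeriv_fourier_le (K := 0) (N := (2 * n : ℕ)) (k := 0)
    (n := 2 * n) (f := f) (by exact_mod_cast hf) (by
      intro k i hk hi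
      have hk : k = 0 := by simpa using hk
      subst hk
      simpa using hint i (by exact_mod_cast hi)) le_rfl le_rfl w
  have key0 : ‖𝓕 f w‖ ≤ V * B := by
    refine (VectorFourier.norm_fourierIntegral_le_integral_norm _ _ _ f w).trans ?_
    simpa using hI 0 (Nat.zero_le _)
  have key1 : ‖w‖ ^ (2 * n) * ‖𝓕 f w‖ ≤ 2 ^ (2 * n) * ((2 * n + 1) * V) * B := by
    simp only [norm_iteratedFDeriv_zero, pow_zero, one_mul, Nat.cast_zero, mul_zero, zero_add,
      Finset.range_one, Finset.singleton_product, Finset.sum_map] at key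
    refine key.trans ?_
    rw [mul_assoc]
    refine mul_le_mul_of_nonneg_left ?_ (by positivity)
    refine (Finset.sum_le_sum (g := fun _ => V * B) fun i hi => ?_).trans ?_
    · simpa using hI i (by simpa [Nat.lt_succ_iff] using hi)
    · simp [mul_assoc]
  rw [← div_eq_mul_inv, le_div_iff₀ (by positivity), mul_comm]
  have hpow : (1 + ‖w‖ ^ 2) ^ n ≤ 2 ^ n * (1 + ‖w‖ ^ (2 * n)) := by
    have := add_pow_le (zero_le_one' ℝ) (sq_nonneg ‖w‖) n
    rw [one_pow, ← pow_mul] at this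
    refine this.trans (mul_le_mul_of_nonneg_right ?_ (by positivity))
    exact pow_le_pow_right₀ (by norm_num) (Nat.sub_le n 1)
  calc _ ≤ 2 ^ n * (1 + ‖w‖ ^ (2 * n)) * ‖𝓕 f w‖ := by gcongr
    _ = 2 ^ n * (‖𝓕 f w‖ + ‖w‖ ^ (2 * n) * ‖𝓕 f w‖) := by ring
    _ ≤ 2 ^ n * (V * B + 2 ^ (2 * n) * ((2 * n + 1) * V) * B) := by gcongr
    _ = _ := by ring

/-- Self-adjointness of the Fourier transform, where one factor is merely in `L²`, so that its
Fourier transform is the one defined by Plancherel's theorem. -/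
lemma integral_mul_fourier_eq {p : E → ℂ} (hp : Integrable p) (hp2 : MemLp p 2)
    (hq2 : MemLp (𝓕 p) 2) (γ : Lp ℂ 2 (volume : Measure E)) :
    ∫ η, p η * (𝓕 γ : Lp ℂ 2 (volume : Measure E)) η = ∫ y, 𝓕 p y * γ y := by
  have hpair : ∀ {f : E → ℂ}, MemLp f 2 → ∃ T : Lp ℂ 2 (volume : Measure E) →L[ℂ] ℂ,
      ∀ g, T g = ∫ y, f y * g y := by
    intro f hf
    refine ⟨(ContinuousLinearMap.mul ℂ ℂ).lpPairing volume 2 2 hf.toLp, fun g => ?_⟩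
    rw [ContinuousLinearMap.lpPairing_eq_integral]
    refine integral_congr_ae ?_
    filter_upwards [hf.coeFn_toLp] with x hx
    simp [hx]
  obtain ⟨T, hT⟩ := hpair hp2
  obtain ⟨S, hS⟩ := hpair hq2
  rw [← hT, ← hS]
  -- both sides are continuous in `γ`, and Schwartz functions are dense in `L²`
  refine DenseRange.induction_on (p := fun γ : Lp ℂ 2 (volume : Measure E) => T (𝓕 γ) = S γ)
    (SchwartzMap.denseRange_toLpCLM (p := 2) ENNReal.ofNat_ne_top) γ ?_ ?_
  · exact isClosed_eq (T.continuous.comp (Lp.fourierTransformₗᵢ E ℂ).continuous) S.continuous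
  · intro f
    change T (𝓕 (f.toLp 2)) = S (f.toLp 2)
    rw [SchwartzMap.toLp_fourier_eq, hT, hS]
    have h1 : ∫ y, p y * ((𝓕 f).toLp 2 volume) y = ∫ y, p y * 𝓕 (f : E → ℂ) y := by
      refine integral_congr_ae ?_
      filter_upwards [(𝓕 f).coeFn_toLp 2 volume] with x hx
      simp [hx, SchwartzMap.fourier_coe]
    have h2 : ∫ y, 𝓕 p y * (f.toLp 2 volume) y = ∫ y, 𝓕 p y * f y := by
      refine integral_congr_ae ?_
      filter_upwards [f.coeFn_toLp 2 volume] with x hx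
      simp [hx]
    rw [h1, h2]
    simpa using! (VectorFourier.integral_fourierIntegral_smul_eq_flip (L := innerₗ E)
      Real.continuous_fourierChar continuous_inner hp f.integrable).symm

end Decay

/-! ### Coordinates adapted to a hyperplane -/

namespace Hyperplane

variable {d : ℕ} (h : Hyperplane d)

/-- The isometry `(y, τ) ↦ J y + τ n` of `ℝ^{d-1} × ℝ`, with the `ℓ²` norm, into `ℝ^d`. -/
def chart : WithLp 2 (Eucl (d - 1) × ℝ) →ₗᵢ[ℝ] Eucl d where
  toFun z := h.J z.fst + z.snd • h.n
  map_add' x y := by simp only [WithLp.add_fst, WithLp.add_snd, map_add, add_smul]; abel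
  map_smul' c x := by simp [smul_smul]
  norm_map' z := by
    have h1 : ‖h.J z.fst + z.snd • h.n‖ ^ 2 = ‖z‖ ^ 2 := by
      rw [norm_add_sq_real, inner_smul_right, h.orth, h.J.norm_map, norm_smul, h.norm_n,
        WithLp.prod_norm_sq_eq_of_L2]
      simp
    exact (pow_left_inj₀ (norm_nonneg _) (norm_nonneg _) two_ne_zero).1 h1

/-- `(y, τ) ↦ J y + τ n` as an isometric isomorphism. -/
def chartEquiv (hd : 1 ≤ d) : WithLp 2 (Eucl (d - 1) × ℝ) ≃ₗᵢ[ℝ] Eucl d :=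
  h.chart.toLinearIsometryEquiv (by
    rw [(WithLp.linearEquiv 2 ℝ (Eucl (d - 1) × ℝ)).finrank_eq]
    simp [Nat.sub_add_cancel hd])

lemma measurePreserving_chart (hd : 1 ≤ d) :
    MeasurePreserving (fun z : Eucl (d - 1) × ℝ => h.J z.1 + z.2 • h.n) :=
  (h.chartEquiv hd).measurePreserving.comp (WithLp.volume_preserving_toLp (Eucl (d - 1)) ℝ)

lemma measurableEmbedding_chart (hd : 1 ≤ d) :
    MeasurableEmbedding (fun z : Eucl (d - 1) × ℝ => h.J z.1 + z.2 • h.n) :=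
  (h.chartEquiv hd).toMeasurableEquiv.measurableEmbedding.comp
    (MeasurableEquiv.toLp 2 (Eucl (d - 1) × ℝ)).measurableEmbedding

lemma adjoint_J_apply (y : Eucl (d - 1)) (τ : ℝ) :
    ContinuousLinearMap.adjoint h.J.toContinuousLinearMap (h.J y + τ • h.n) = y := by
  refine ext_inner_right ℝ fun w => ?_
  rw [ContinuousLinearMap.adjoint_inner_left]
  change ⟪h.J y + τ • h.n, h.J w⟫ = _
  rw [inner_add_left, inner_smul_left, real_inner_comm (h.J w) h.n, h.orth, h.J.inner_map_map]
  simp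

lemma J_adjoint_apply (hd : 1 ≤ d) {x : Eucl d} (hx : ⟪x, h.n⟫ = 0) :
    h.J (ContinuousLinearMap.adjoint h.J.toContinuousLinearMap x) = x := by
  obtain ⟨z, rfl⟩ := (h.chartEquiv hd).surjective x
  change h.J (ContinuousLinearMap.adjoint h.J.toContinuousLinearMap
    (h.J z.fst + z.snd • h.n)) = h.J z.fst + z.snd • h.n
  change ⟪h.J z.fst + z.snd • h.n, h.n⟫ = 0 at hx
  rw [inner_add_left, inner_smul_left, h.orth, real_inner_self_eq_norm_sq, h.norm_n] at hx
  have : z.snd = 0 := by simpa using hx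
  rw [h.adjoint_J_apply, this]
  simp

/-- Integrating a function on `ℝ^d` against the Fourier transform of the layer `γ δ_h` amounts to
integrating the restriction of its Fourier transform to the direction of `h` against `γ`. -/
lemma integral_mul_fourier_layer (hd : 1 ≤ d) {M : Eucl d → ℂ} (hM : Continuous M)
    (hMc : HasCompactSupport M) (hM2 : MemLp (fun y => 𝓕 M (h.J y)) 2)
    (γ : Lp ℂ 2 (volume : Measure (Eucl (d - 1)))) :
    ∫ ξ, M ξ * (𝓕 γ : Lp ℂ 2 (volume : Measure (Eucl (d - 1))))
      (ContinuousLinearMap.adjoint h.J.toContinuousLinearMap ξ) =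
    ∫ y, 𝓕 M (h.J y) * γ y := by
  set g : Eucl (d - 1) → ℂ := ⇑(𝓕 γ : Lp ℂ 2 (volume : Measure (Eucl (d - 1))))
  have hgL2 : MemLp g 2 := Lp.memLp _
  let c : Eucl (d - 1) × ℝ → Eucl d := fun z => h.J z.1 + z.2 • h.n
  have hc : Continuous c := by fun_prop
  have hcn : ∀ z, ‖c z‖ ^ 2 = ‖z.1‖ ^ 2 + z.2 ^ 2 := by
    intro z
    have := h.chart.norm_map (WithLp.toLp 2 z)
    rw [show c z = h.chart (WithLp.toLp 2 z) from rfl, this, WithLp.prod_norm_sq_eq_of_L2]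
    simp
  obtain ⟨r, hr0, hr⟩ : ∃ r, 0 < r ∧ ∀ ξ, M ξ ≠ 0 → ‖ξ‖ ≤ r := by
    obtain ⟨r, hr0, hr⟩ := hMc.isCompact.isBounded.subset_closedBall_lt 0 0
    exact ⟨r, hr0, fun ξ hξ => by simpa using hr (subset_tsupport _ hξ)⟩
  have hr1 : ∀ z, M (c z) ≠ 0 → ‖z.1‖ ≤ r := fun z hz => by
    have h1 := hr _ hz
    have h2 := hcn z
    nlinarith [norm_nonneg z.1, sq_nonneg z.2, norm_nonneg (c z)]
  have hr2 : ∀ z, M (c z) ≠ 0 → ‖z.2‖ ≤ r := fun z hz => by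
    have h1 := hr _ hz
    have h2 := hcn z
    have : ‖z.2‖ ^ 2 = z.2 ^ 2 := by simp
    nlinarith [norm_nonneg z.2, sq_nonneg ‖z.1‖, norm_nonneg (c z)]
  obtain ⟨K, hK⟩ := hMc.exists_bound_of_continuous hM
  have hK0 : 0 ≤ K := (norm_nonneg _).trans (hK 0)
  -- the integral of `M` over the lines in direction `n`
  let p : Eucl (d - 1) → ℂ := fun η => ∫ τ, M (c (η, τ))
  have hp : Continuous p := by
    have : p = fun η => ∫ τ in Metric.closedBall (0 : ℝ) r, M (c (η, τ)) := by
      funext η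
      refine (setIntegral_eq_integral_of_forall_compl_eq_zero fun τ hτ => ?_).symm
      by_contra hne
      exact hτ (by simpa using hr2 _ hne)
    rw [this]
    exact continuous_parametric_integral_of_continuous (by fun_prop) (isCompact_closedBall _ _)
  have hpc : HasCompactSupport p := by
    refine HasCompactSupport.intro (isCompact_closedBall 0 r) fun η hη => ?_
    refine integral_eq_zero_of_ae (Eventually.of_forall fun τ => ?_)
    by_contra hne
    exact hη (by simpa using hr1 _ hne)
  have hMcc : HasCompactSupport (fun z => M (c z)) := by
    refine HasCompactSupport.intro ((isCompact_closedBall 0 r).prod (isCompact_closedBall 0 r))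
      fun z hz => ?_
    by_contra hne
    exact hz ⟨by simpa using hr1 _ hne, by simpa using hr2 _ hne⟩
  have hfp : ∀ y, 𝓕 p y = 𝓕 M (h.J y) := by
    intro y
    rw [Real.fourier_eq, Real.fourier_eq,
      ← (h.measurePreserving_chart hd).integral_comp (h.measurableEmbedding_chart hd)]
    change _ = ∫ z : Eucl (d - 1) × ℝ, Real.fourierChar (-⟪c z, h.J y⟫) • M (c z)
    have hin : ∀ z, ⟪c z, h.J y⟫ = ⟪z.1, y⟫ := by
      intro z
      change ⟪h.J z.1 + z.2 • h.n, h.J y⟫ = _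
      rw [inner_add_left, inner_smul_left, real_inner_comm (h.J y) h.n, h.orth, h.J.inner_map_map]
      simp
    simp only [hin]
    rw [Measure.volume_eq_prod, integral_prod]
    · refine integral_congr_ae (Eventually.of_forall fun η => ?_)
      simp only [Circle.smul_def]
      exact (integral_smul (Real.fourierChar (-⟪η, y⟫) : ℂ) (fun τ => M (c (η, τ)))).symm
    · refine Continuous.integrable_of_hasCompactSupport (by fun_prop) ?_
      exact hMcc.smul_left
  have hlhs : ∫ ξ, M ξ * g (ContinuousLinearMap.adjoint h.J.toContinuousLinearMap ξ) =
      ∫ η, p η * g η := by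
    rw [← (h.measurePreserving_chart hd).integral_comp (h.measurableEmbedding_chart hd)]
    simp only [h.adjoint_J_apply]
    rw [Measure.volume_eq_prod, integral_prod]
    · exact integral_congr_ae (Eventually.of_forall fun η =>
        integral_mul_const (g η) (fun τ => M (c (η, τ))))
    · have hgi : Integrable ((Metric.closedBall (0 : Eucl (d - 1)) r).indicator g) :=
        ((hgL2.locallyIntegrable (by norm_num)).integrableOn_isCompact
          (isCompact_closedBall _ _)).integrable_indicator measurableSet_closedBall
      have hone : Integrable ((Metric.closedBall (0 : ℝ) r).indicator (fun _ => K)) :=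
        (integrableOn_const measure_closedBall_lt_top.ne).integrable_indicator
          measurableSet_closedBall
      refine (hgi.norm.mul_prod hone).mono' ?_ (Eventually.of_forall fun z => ?_)
      · exact (hM.comp hc).aestronglyMeasurable.mul
          (hgL2.aestronglyMeasurable.comp_quasiMeasurePreserving Measure.quasiMeasurePreserving_fst)
      · by_cases hz : M (c z) = 0
        · change ‖M (c z) * _‖ ≤ _
          rw [hz, zero_mul, norm_zero]
          exact mul_nonneg (norm_nonneg _) (Set.indicator_nonneg (fun _ _ => hK0) _)
        · rw [Set.indicator_of_mem (by simpa using hr1 z hz),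
            Set.indicator_of_mem (by simpa using hr2 z hz), norm_mul, mul_comm]
          gcongr
          exact hK _
  rw [hlhs, integral_mul_fourier_eq (hp.integrable_of_hasCompactSupport hpc)
    (hp.memLp_of_hasCompactSupport hpc)]
  · simp only [hfp]
  · simpa only [funext hfp] using hM2

end Hyperplane

/-! ### A smooth cut-off of the inversion -/

section Inversion

variable {E : Type*} [NormedAddCommGroup E] [InnerProductSpace ℝ E] [FiniteDimensional ℝ E]

variable (E) in
/-- There is a compactly supported smooth vector field that coincides with the inversion
`x ↦ x / |x|²` in the shell `1/2 < |x| < 2`. -/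
lemma exists_smooth_inversion :
    ∃ V : E → E, ContDiff ℝ ∞ V ∧ HasCompactSupport V ∧
      ∀ x, 1 / 2 < ‖x‖ → ‖x‖ < 2 → V x = (‖x‖ ^ 2)⁻¹ • x := by
  let χ₁ : ContDiffBump (0 : E) := ⟨2, 3, by norm_num, by norm_num⟩
  let χ₂ : ContDiffBump (0 : E) := ⟨1 / 4, 1 / 2, by norm_num, by norm_num⟩
  refine ⟨fun x => (χ₁ x * (1 - χ₂ x)) • (‖x‖ ^ 2)⁻¹ • x, ?_, ?_, ?_⟩
  · rw [contDiff_iff_contDiffAt]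
    intro x
    rcases eq_or_ne x 0 with rfl | hx
    · refine (contDiffAt_const (c := 0)).congr_of_eventuallyEq ?_
      filter_upwards [Metric.ball_mem_nhds (0 : E) (show (0 : ℝ) < 1 / 4 by norm_num)] with y hy
      rw [χ₂.one_of_mem_closedBall (Metric.ball_subset_closedBall hy)]
      simp
    · have h1 : ContDiffAt ℝ ∞ (fun x : E => (‖x‖ ^ 2)⁻¹) x :=
        (contDiff_norm_sq ℝ).contDiffAt.inv (by simpa using hx)
      exact ((χ₁.contDiff.contDiffAt).mul (contDiffAt_const.sub χ₂.contDiff.contDiffAt)).smul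
        (h1.smul contDiffAt_id)
  · exact χ₁.hasCompactSupport.mul_right.smul_right
  · intro x h1 h2
    have e1 : χ₁ x = 1 := χ₁.one_of_mem_closedBall (by simpa [χ₁] using h2.le)
    have e2 : χ₂ x = 0 := χ₂.zero_of_le_dist (by simpa [χ₂] using h1.le)
    simp [e1, e2]

end Inversion

/-! ### Bounds for symbols -/

section Symbol

variable {E : Type*} [NormedAddCommGroup E] [InnerProductSpace ℝ E]

lemma norm_sq_stretch {c : E} (hc : ‖c‖ = 1) (a : ℝ) (x : E) :
    ‖stretch a c x‖ ^ 2 = ‖x‖ ^ 2 + (a ^ 2 - 1) * ⟪c, x⟫ ^ 2 := by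
  rw [stretch_apply, norm_add_sq_real, inner_smul_right, norm_smul, hc, real_inner_comm, mul_one,
    Real.norm_eq_abs, sq_abs]
  ring

lemma inner_sq_le_norm_sq {c : E} (hc : ‖c‖ = 1) (x : E) : ⟪c, x⟫ ^ 2 ≤ ‖x‖ ^ 2 := by
  have h := abs_real_inner_le_norm c x
  rw [hc, one_mul] at h
  exact sq_le_sq' (by linarith [neg_abs_le ⟪c, x⟫]) ((le_abs_self _).trans h)

lemma norm_stretch_le {c : E} (hc : ‖c‖ = 1) {a : ℝ} (ha : 1 ≤ a) (x : E) :
    ‖stretch a c x‖ ≤ a * ‖x‖ := by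
  refine (pow_le_pow_iff_left₀ (norm_nonneg _) (by positivity) two_ne_zero).1 ?_
  rw [norm_sq_stretch hc, mul_pow]
  nlinarith [inner_sq_le_norm_sq hc x, mul_nonneg (sub_nonneg.2 ha) (by linarith : 0 ≤ a + 1)]

variable (E) in
/-- Uniform bounds for the derivatives of the product of a window `W` with a fixed smooth vector
field, after the latter has been composed with a contraction and paired with a unit vector. -/
lemma exists_bound_mul_inner {V : E → E} (hV : ContDiff ℝ ∞ V) (hVc : HasCompactSupport V)
    (N : ℕ) : ∃ C : ℝ, 0 ≤ C ∧ ∀ (W : E → ℝ) (B : ℝ), ContDiff ℝ N W →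
      (∀ i ≤ N, ∀ x, ‖iteratedFDeriv ℝ i W x‖ ≤ B) → ∀ (D : E →L[ℝ] E), ‖D‖ ≤ 1 →
      ∀ ν : E, ‖ν‖ = 1 →
      ContDiff ℝ N (fun η => ((W η * ⟪ν, V (D η)⟫ : ℝ) : ℂ)) ∧
      ∀ i ≤ N, ∀ x, ‖iteratedFDeriv ℝ i (fun η => ((W η * ⟪ν, V (D η)⟫ : ℝ) : ℂ)) x‖ ≤ C * B := by
  have hb : ∀ i : ℕ, ∃ K, ∀ x, ‖iteratedFDeriv ℝ i V x‖ ≤ K := fun i =>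
    (hVc.iteratedFDeriv i).exists_bound_of_continuous
      (hV.continuous_iteratedFDeriv (by exact_mod_cast le_top))
  choose K hK using hb
  have hK0 : ∀ i, 0 ≤ K i := fun i => (norm_nonneg _).trans (hK i 0)
  set K' := ∑ i ∈ Finset.range (N + 1), K i
  have hKle : ∀ i ≤ N, K i ≤ K' := fun i hi =>
    Finset.single_le_sum (f := K) (fun i _ => hK0 i) (Finset.mem_range.2 (Nat.lt_succ_of_le hi))
  have hK'0 : 0 ≤ K' := Finset.sum_nonneg fun i _ => hK0 i
  refine ⟨2 ^ N * K', by positivity, fun W B hW hB D hD ν hν => ?_⟩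
  have hB0 : 0 ≤ B := (norm_nonneg _).trans (hB 0 (Nat.zero_le _) 0)
  have hVN : ContDiff ℝ N V := hV.of_le (by exact_mod_cast le_top)
  have hVD : ContDiff ℝ N (V ∘ D) := hVN.comp D.contDiff
  set G : E → ℝ := fun η => ⟪ν, V (D η)⟫ with hG
  have hGs : ContDiff ℝ N G := contDiff_const.inner ℝ hVD
  have hGb : ∀ i ≤ N, ∀ x, ‖iteratedFDeriv ℝ i G x‖ ≤ K' := by
    intro i hi x
    have h1 := (innerSL ℝ ν).norm_iteratedFDeriv_comp_left (f := V ∘ D) (x := x) (n := i)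
      hVD.contDiffAt (by exact_mod_cast hi)
    rw [innerSL_apply_norm, hν, one_mul] at h1
    refine h1.trans ?_
    rw [D.iteratedFDeriv_comp_right hVN x (by exact_mod_cast hi)]
    refine (ContinuousMultilinearMap.norm_compContinuousLinearMap_le _ _).trans ?_
    rw [Finset.prod_const]
    calc _ ≤ K i * 1 := by
          gcongr
          · exact hK0 i
          · exact hK i _
          · exact pow_le_one₀ (norm_nonneg _) hD
      _ ≤ K' := by rw [mul_one]; exact hKle i hi
  have hWG : ContDiff ℝ N (fun η => W η * G η) := hW.mul hGs
  refine ⟨Complex.ofRealCLM.contDiff.comp hWG, fun i hi x => ?_⟩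
  have h2 := Complex.ofRealLI.norm_iteratedFDeriv_comp_left (f := fun η => W η * G η) (x := x)
    hWG.contDiffAt (i := i) (by exact_mod_cast hi)
  change ‖iteratedFDeriv ℝ i (Complex.ofRealLI ∘ fun η => W η * G η) x‖ ≤ _
  rw [h2]
  refine (norm_iteratedFDeriv_mul_le hW hGs x (by exact_mod_cast hi)).trans ?_
  calc _ ≤ ∑ k ∈ Finset.range (i + 1), (i.choose k : ℝ) * (B * K') := by
        refine Finset.sum_le_sum fun k hk => ?_
        have hk : k ≤ i := Nat.lt_succ_iff.1 (Finset.mem_range.1 hk)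
        rw [mul_assoc]
        gcongr
        · exact hB k (hk.trans hi) x
        · exact hGb _ ((Nat.sub_le _ _).trans hi) x
    _ = 2 ^ i * (B * K') := by
        rw [← Finset.sum_mul]
        congr 1
        exact_mod_cast Nat.sum_range_choose i
    _ ≤ 2 ^ N * (B * K') := by
        gcongr
        norm_num
    _ = _ := by ring

variable [FiniteDimensional ℝ E] [MeasurableSpace E] [BorelSpace E]

lemma fourier_comp_stretch (R : E ≃ₗᵢ[ℝ] E) (F : E → ℂ) {T : ℝ} (hT : 0 < T) {c : E}
    (hc : ‖c‖ = 1) (w : E) :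
    𝓕 (fun ξ => F (stretch T⁻¹ c (R ξ))) w = T • 𝓕 F (stretch T c (R w)) := by
  rw [Real.fourier_eq, Real.fourier_eq]
  have h1 : ∀ ξ, Real.fourierChar (-⟪ξ, w⟫) • F (stretch T⁻¹ c (R ξ)) =
      (fun η => Real.fourierChar (-⟪η, stretch T c (R w)⟫) • F η) (stretch T⁻¹ c (R ξ)) := by
    intro ξ
    simp only [inner_stretch_comm, stretch_stretch hc, inv_mul_cancel₀ hT.ne', stretch_one,
      R.inner_map_map]
  rw [integral_congr_ae (Eventually.of_forall h1)]
  rw [R.measurePreserving.integral_comp R.toMeasurableEquiv.measurableEmbedding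
    (fun x => (fun η => Real.fourierChar (-⟪η, stretch T c (R w)⟫) • F η) (stretch T⁻¹ c x)),
    integral_comp_stretch (inv_ne_zero hT.ne') hc
      (fun η => Real.fourierChar (-⟪η, stretch T c (R w)⟫) • F η), inv_inv, abs_of_pos hT]

end Symbol

/-! ### The geometry of the translated and stretched hyperplane -/

section Geometry

variable {E E' : Type*} [NormedAddCommGroup E] [InnerProductSpace ℝ E]
  [NormedAddCommGroup E'] [InnerProductSpace ℝ E']

lemma one_le_aniso (j : ℕ) (φ : ℝ) : 1 ≤ aniso j φ := by
  rw [aniso, Real.one_le_sqrt]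
  have h1 : (1 : ℝ) ≤ 2 ^ (2 * j) := one_le_pow₀ (by norm_num)
  nlinarith [Real.sin_sq_add_cos_sq φ, sq_nonneg (Real.sin φ)]

/-- In coordinates adapted to it, the image of a hyperplane under the stretching map is again a
hyperplane: `|ρ₁|` is the distance of `t` from it, and on it the map acts as a stretching by the factor
`a`. The second part is Peetre's inequality for the weights. -/
lemma exists_stretch_hyperplane (J : E' →ₗᵢ[ℝ] E) {e b : E} (he : ‖e‖ = 1) (hb : ‖b‖ = 1)
    (heb : ⟪e, b⟫ = 0) (j : ℕ) (φ : ℝ)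
    (horth : ∀ y, ⟪J y, Real.cos φ • e - Real.sin φ • b⟫ = 0)
    (hrange : ∀ x, ⟪x, Real.cos φ • e - Real.sin φ • b⟫ = 0 → ∃ y, J y = x) (t : E) :
    ∃ (c y₀ : E'), ‖c‖ = 1 ∧ ∀ y,
      ‖stretch (2 ^ j) e (J y) - t‖ ^ 2 =
        rho1 j φ ⟪e, t⟫ ⟪b, t⟫ ^ 2 + ‖stretch (aniso j φ) c y - y₀‖ ^ 2 ∧
      ‖t - ⟪e, t⟫ • e - ⟪b, t⟫ • b‖ ^ 2 + rho1 j φ ⟪e, t⟫ ⟪b, t⟫ ^ 2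
        + rho2 j φ ⟪e, t⟫ ⟪b, t⟫ ^ 2 + 1 ≤
        2 * (1 + ‖y‖ ^ 2) * (1 + ‖stretch (2 ^ j) e (J y) - t‖ ^ 2) := by
  set C := Real.cos φ with hC
  set S := Real.sin φ with hS
  set T : ℝ := 2 ^ j with hT
  set a := aniso j φ with ha
  set t₁ := ⟪e, t⟫ with ht₁
  set t₂ := ⟪b, t⟫ with ht₂
  set t' := t - t₁ • e - t₂ • b with ht'
  have hCS : S ^ 2 + C ^ 2 = 1 := Real.sin_sq_add_cos_sq φ
  have ha1 : 1 ≤ a := one_le_aniso j φ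
  have ha0 : a ≠ 0 := by positivity
  have ha2 : a ^ 2 = T ^ 2 * S ^ 2 + C ^ 2 := by
    rw [ha, aniso, Real.sq_sqrt (by positivity), hT, ← pow_mul, mul_comm j 2]
  have hee : ⟪e, e⟫ = 1 := by rw [real_inner_self_eq_norm_sq, he]; norm_num
  have hbb : ⟪b, b⟫ = 1 := by rw [real_inner_self_eq_norm_sq, hb]; norm_num
  have hbe : ⟪b, e⟫ = 0 := by rw [real_inner_comm, heb]
  have het' : ⟪e, t'⟫ = 0 := by
    simp [ht', inner_sub_right, inner_smul_right, he, heb, ← ht₁]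
  have hbt' : ⟪b, t'⟫ = 0 := by
    simp [ht', inner_sub_right, inner_smul_right, hb, hbe, ← ht₂]
  obtain ⟨c, hc⟩ := hrange (S • e + C • b) (by
    simp only [inner_add_left, inner_sub_right, inner_smul_left, inner_smul_right, hee, hbb, heb,
      hbe, RCLike.conj_to_real]
    ring)
  obtain ⟨w, hw⟩ := hrange t' (by
    rw [inner_sub_right, inner_smul_right, inner_smul_right, real_inner_comm, het',
      real_inner_comm, hbt']
    ring)
  set ρ₁ := rho1 j φ t₁ t₂ with hρ₁
  set ρ₂ := rho2 j φ t₁ t₂ with hρ₂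
  have h1 : a * ρ₁ = C * t₁ - T * S * t₂ := by
    rw [hρ₁, rho1, ← ha]; field_simp; ring
  have h2 : a ^ 2 * ρ₂ = T * S * t₁ + C * t₂ := by
    rw [hρ₂, rho2, ← ha]; field_simp; ring
  have h3 : ρ₁ ^ 2 + a ^ 2 * ρ₂ ^ 2 = t₁ ^ 2 + t₂ ^ 2 := by
    have : a ^ 2 * (ρ₁ ^ 2 + a ^ 2 * ρ₂ ^ 2) = a ^ 2 * (t₁ ^ 2 + t₂ ^ 2) := by
      calc _ = (a * ρ₁) ^ 2 + (a ^ 2 * ρ₂) ^ 2 := by ring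
        _ = _ := by rw [h1, h2, ha2]; ring
    exact mul_left_cancel₀ (pow_ne_zero 2 ha0) this
  refine ⟨c, (a * ρ₂) • c + w, ?_, fun y => ?_⟩
  · rw [← J.norm_map, hc]
    have : ‖S • e + C • b‖ ^ 2 = 1 ^ 2 := by
      rw [norm_add_sq_real, norm_smul, norm_smul, inner_smul_left, inner_smul_right, heb, he, hb]
      simp only [Real.norm_eq_abs, mul_one, sq_abs, mul_zero, add_zero, one_pow]
      exact hCS
    exact (pow_left_inj₀ (norm_nonneg _) zero_le_one two_ne_zero).1 this
  set p := ⟪c, y⟫ with hp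
  have hp1 : S * ⟪e, J y⟫ + C * ⟪b, J y⟫ = p := by
    rw [hp, ← J.inner_map_map, hc, inner_add_left, inner_smul_left, inner_smul_left]
    simp
  have hp2 : C * ⟪e, J y⟫ - S * ⟪b, J y⟫ = 0 := by
    have := horth y
    rwa [inner_sub_right, inner_smul_right, inner_smul_right, real_inner_comm,
      real_inner_comm b] at this
  have hey : ⟪e, J y⟫ = S * p := by linear_combination S * hp1 + C * hp2 - ⟪e, J y⟫ * hCS
  have hby : ⟪b, J y⟫ = C * p := by linear_combination C * hp1 - S * hp2 - ⟪b, J y⟫ * hCS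
  -- the components orthogonal to `e` and `b`
  set f := J y - (S * p) • e - (C * p) • b with hf
  have hef : ⟪e, f⟫ = 0 := by
    simp [hf, inner_sub_right, inner_smul_right, he, heb, hey]
  have hbf : ⟪b, f⟫ = 0 := by
    simp [hf, inner_sub_right, inner_smul_right, hb, hbe, hby]
  set g := f - t' with hg
  have hpyth : ∀ (x : E) (α β : ℝ), ⟪e, x⟫ = 0 → ⟪b, x⟫ = 0 →
      ‖x + α • e + β • b‖ ^ 2 = ‖x‖ ^ 2 + α ^ 2 + β ^ 2 := by
    intro x α β hx1 hx2
    rw [norm_add_sq_real, norm_add_sq_real, inner_add_left, inner_smul_right, inner_smul_right,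
      inner_smul_left, inner_smul_right, norm_smul, norm_smul, he, hb, heb, real_inner_comm, hx1,
      real_inner_comm, hx2]
    simp
  have heg : ⟪e, g⟫ = 0 := by rw [hg, inner_sub_right, hef, het', sub_zero]
  have hbg : ⟪b, g⟫ = 0 := by rw [hg, inner_sub_right, hbf, hbt', sub_zero]
  have hz : ‖stretch T e (J y) - t‖ ^ 2 = ‖g‖ ^ 2 + (T * S * p - t₁) ^ 2 + (C * p - t₂) ^ 2 := by
    rw [← hpyth g _ _ heg hbg, stretch_apply, hey]
    congr 2
    rw [hg, hf, ht']
    module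
  have hs : ‖stretch a c y - ((a * ρ₂) • c + w)‖ ^ 2 = ‖g‖ ^ 2 + a ^ 2 * (p - ρ₂) ^ 2 := by
    rw [← J.norm_map, map_sub, map_add, stretch_apply, map_add, map_smul, map_smul, hc, hw, ← hp]
    have : J y + ((a - 1) * p) • (S • e + C • b) - ((a * ρ₂) • (S • e + C • b) + t') =
        g + (a * (p - ρ₂) * S) • e + (a * (p - ρ₂) * C) • b := by
      rw [hg, hf]
      module
    rw [this, hpyth g _ _ heg hbg]
    linear_combination (a ^ 2 * (p - ρ₂) ^ 2) * hCS
  have hy : ‖y‖ ^ 2 = ‖f‖ ^ 2 + p ^ 2 := by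
    have : J y = f + (S * p) • e + (C * p) • b := by rw [hf]; module
    rw [← J.norm_map, this, hpyth f _ _ hef hbf]
    linear_combination p ^ 2 * hCS
  have hzs : ‖stretch T e (J y) - t‖ ^ 2 = ρ₁ ^ 2 + (‖g‖ ^ 2 + a ^ 2 * (p - ρ₂) ^ 2) := by
    rw [hz]
    linear_combination -h3 - p ^ 2 * ha2 + 2 * p * h2
  refine ⟨by rw [hzs, hs], ?_⟩
  rw [hzs, hy]
  have hft : ‖t'‖ ^ 2 ≤ 2 * ‖f‖ ^ 2 + 2 * ‖g‖ ^ 2 := by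
    have : ‖t'‖ ≤ ‖f‖ + ‖g‖ := by
      rw [show t' = f - g by rw [hg]; abel]
      exact norm_sub_le _ _
    have h4 := (pow_le_pow_left₀ (norm_nonneg _) this 2).trans (add_sq_le (a := ‖f‖) (b := ‖g‖))
    linarith
  have hρ : ρ₂ ^ 2 ≤ 2 * p ^ 2 + 2 * (a ^ 2 * (p - ρ₂) ^ 2) := by
    have : (p - ρ₂) ^ 2 ≤ a ^ 2 * (p - ρ₂) ^ 2 :=
      le_mul_of_one_le_left (sq_nonneg _) (one_le_pow₀ ha1)
    have h4 : 0 ≤ 2 * p ^ 2 + 2 * (p - ρ₂) ^ 2 - ρ₂ ^ 2 := by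
      rw [show 2 * p ^ 2 + 2 * (p - ρ₂) ^ 2 - ρ₂ ^ 2 = (2 * p - ρ₂) ^ 2 by ring]
      positivity
    linarith
  calc _ ≤ 2 + 2 * (‖f‖ ^ 2 + p ^ 2) + 2 * (ρ₁ ^ 2 + (‖g‖ ^ 2 + a ^ 2 * (p - ρ₂) ^ 2)) := by
        linarith [sq_nonneg ρ₁]
    _ ≤ 2 + 2 * (‖f‖ ^ 2 + p ^ 2) + 2 * (ρ₁ ^ 2 + (‖g‖ ^ 2 + a ^ 2 * (p - ρ₂) ^ 2)) +
        2 * ((‖f‖ ^ 2 + p ^ 2) * (ρ₁ ^ 2 + (‖g‖ ^ 2 + a ^ 2 * (p - ρ₂) ^ 2))) :=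
        le_add_of_nonneg_right (by positivity)
    _ = _ := by ring

end Geometry

/-! ### Ridgelets on the frequency side -/

section Frequency

variable {d : ℕ} [NeZero d]

lemma norm_e1 : ‖e1 d‖ = 1 := by simp [e1]

lemma inner_e1 (x : Eucl d) : ⟪e1 d, x⟫ = x 0 := by
  simp [e1, EuclideanSpace.inner_single_left]

lemma dilate_eq_stretch (a : ℝ) (x : Eucl d) : dilate a x = stretch a (e1 d) x := by
  ext i
  rw [stretch_apply, inner_e1]
  by_cases hi : i = 0
  · subst hi
    simp [dilate, setFirst, e1]
    ring
  · simp [dilate, setFirst, e1, hi]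

lemma mem_polarRect_iff {d : ℕ} {σ ξ : Eucl d} {j : ℕ} :
    ξ ∈ polarRect σ j ↔ (2 : ℝ) ^ j / 2 < ‖ξ‖ ∧ ‖ξ‖ < 2 * 2 ^ j ∧
      ‖(‖ξ‖⁻¹ : ℝ) • ξ - σ‖ < 2 / 2 ^ j := by
  have h1 : (2 : ℝ) ^ ((j : ℝ) - 1) = 2 ^ j / 2 := by
    rw [Real.rpow_sub two_pos, Real.rpow_natCast, Real.rpow_one]
  have h2 : (2 : ℝ) ^ ((j : ℝ) + 1) = 2 * 2 ^ j := by
    rw [Real.rpow_add two_pos, Real.rpow_natCast, Real.rpow_one, mul_comm]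
  have h3 : (2 : ℝ) ^ (1 - (j : ℝ)) = 2 / 2 ^ j := by
    rw [Real.rpow_sub two_pos, Real.rpow_natCast, Real.rpow_one]
  simp only [polarRect, Set.mem_ofPred_eq, h1, h2, h3]

namespace System

variable (Φ : System d) (j : ℕ) (l : Fin (Φ.L j + 1))

lemma U_eq (x : Eucl d) : Φ.U j l x = (Φ.rot j l).symm (stretch ((2 ^ j)⁻¹) (e1 d) x) := by
  rw [U, dilate_eq_stretch, Real.rpow_neg two_pos.le, Real.rpow_natCast]

lemma Uinv_eq (x : Eucl d) : Φ.Uinv j l x = stretch (2 ^ j) (e1 d) (Φ.rot j l x) := by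
  rw [Uinv, dilate_eq_stretch]

lemma UinvT_eq (x : Eucl d) : Φ.UinvT j l x = (Φ.rot j l).symm (stretch (2 ^ j) (e1 d) x) := by
  rw [UinvT, dilate_eq_stretch]

lemma win_eq_normWin (ξ : Eucl d) :
    Φ.win j l ξ = Φ.normWin j l (stretch ((2 ^ j)⁻¹) (e1 d) (Φ.rot j l ξ)) := by
  rw [normWin, UinvT_eq, stretch_stretch norm_e1, mul_inv_cancel₀ (by positivity), stretch_one,
    LinearIsometryEquiv.symm_apply_apply]

variable {Φ j l}

/-- The map `U^⊤` takes the polar rectangle into a ball whose radius does not depend on the scale. -/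
lemma support_normWin_subset (hs : Function.support (Φ.win j l) ⊆ polarRect (Φ.dir j l) j) :
    Function.support (Φ.normWin j l) ⊆ Metric.closedBall 0 5 := by
  intro η hη
  have h1 := mem_polarRect_iff.1 (hs (show Φ.win j l (Φ.UinvT j l η) ≠ 0 from hη))
  rw [UinvT_eq, ← LinearIsometryEquiv.norm_map (Φ.rot j l) (_ - Φ.dir j l), map_sub, map_smul,
    LinearIsometryEquiv.apply_symm_apply, LinearIsometryEquiv.norm_map, Φ.rot_dir] at h1
  set T : ℝ := 2 ^ j
  have hT : 0 < T := by positivity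
  set x := stretch T (e1 d) η with hx
  obtain ⟨h0, h2, h3⟩ := h1
  have hη : η = stretch T⁻¹ (e1 d) x := by
    rw [hx, stretch_stretch norm_e1, inv_mul_cancel₀ hT.ne', stretch_one]
  have hsq := norm_sq_stretch norm_e1 T⁻¹ x
  rw [← hη] at hsq
  have hx1 := inner_sq_le_norm_sq norm_e1 x
  have hx0 : 0 < ‖x‖ := lt_trans (by positivity) h0
  have h4 : ‖x - ‖x‖ • e1 d‖ ≤ 4 := by
    have : x - ‖x‖ • e1 d = ‖x‖ • (‖x‖⁻¹ • x - e1 d) := by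
      rw [smul_sub, smul_smul, mul_inv_cancel₀ hx0.ne', one_smul]
    rw [this, norm_smul, norm_norm]
    calc _ ≤ 2 * T * (2 / T) := by gcongr
      _ = 4 := by field_simp; norm_num
  have h5 : ‖x‖ ^ 2 - ⟪e1 d, x⟫ ^ 2 ≤ ‖x - ‖x‖ • e1 d‖ ^ 2 := by
    rw [norm_sub_sq_real, inner_smul_right, norm_smul, norm_norm, norm_e1,
      real_inner_comm (e1 d) x]
    nlinarith [sq_nonneg (‖x‖ - ⟪e1 d, x⟫)]
  have h6 : T⁻¹ ^ 2 * ⟪e1 d, x⟫ ^ 2 ≤ 4 := by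
    calc _ ≤ T⁻¹ ^ 2 * (2 * T) ^ 2 := by
          refine mul_le_mul_of_nonneg_left ?_ (by positivity)
          exact hx1.trans (pow_le_pow_left₀ hx0.le h2.le 2)
      _ = 4 := by field_simp; norm_num
  have h7 : ‖x - ‖x‖ • e1 d‖ ^ 2 ≤ 4 ^ 2 := pow_le_pow_left₀ (norm_nonneg _) h4 2
  rw [mem_closedBall_zero_iff]
  refine (pow_le_pow_iff_left₀ (norm_nonneg _) (by norm_num) two_ne_zero).1 ?_
  rw [hsq]
  linarith

lemma fourier_win_eq (w : Eucl d) :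
    𝓕 (fun ξ => (Φ.win j l ξ : ℂ)) w =
      (2 ^ j : ℝ) • 𝓕 (fun η => (Φ.normWin j l η : ℂ)) (Φ.Uinv j l w) := by
  rw [Uinv_eq, ← fourier_comp_stretch _ _ (by positivity) norm_e1]
  simp only [← win_eq_normWin]

/-- By Fourier inversion, which is available because the windows are smooth enough, the Fourier
transform of a ridgelet is a modulated window. -/
lemma fourier_ridgelet {n : ℕ} (hn : d < 2 * n)
    (hW : ContDiff ℝ (2 * n : ℕ) (Φ.normWin j l)) {B : ℝ}
    (hB : ∀ i ≤ 2 * n, ∀ η, ‖iteratedFDeriv ℝ i (Φ.normWin j l) η‖ ≤ B)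
    (hs : Function.support (Φ.win j l) ⊆ polarRect (Φ.dir j l) j) (k : Fin d → ℤ) (ξ : Eucl d) :
    𝓕 (Φ.ridgelet j l k) ξ = ((2 : ℝ) ^ (-(j : ℝ) / 2) : ℝ) *
      (Real.fourierChar (-⟪ξ, Φ.U j l (latticePt k)⟫) * Φ.win j l ξ) := by
  have hsupp := support_normWin_subset hs
  have hWc : ContDiff ℝ (2 * n : ℕ) (fun η => (Φ.normWin j l η : ℂ)) :=
    Complex.ofRealCLM.contDiff.comp hW
  have hcomp : HasCompactSupport (fun η => (Φ.normWin j l η : ℂ)) :=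
    HasCompactSupport.intro (isCompact_closedBall 0 5) fun x hx => by
      have : Φ.normWin j l x = 0 := by_contra fun h => hx (hsupp h)
      simp [this]
  have hint : Integrable (fun η => (Φ.normWin j l η : ℂ)) :=
    hWc.continuous.integrable_of_hasCompactSupport hcomp
  have hwin : (fun ξ => (Φ.win j l ξ : ℂ)) =
      (fun ξ => (Φ.normWin j l (stretch ((2 ^ j)⁻¹) (e1 d) (Φ.rot j l ξ)) : ℂ)) := by
    funext ξ
    rw [← win_eq_normWin]
  have hpull : ∀ {a : ℝ} {f : Eucl d → ℂ}, a ≠ 0 → Integrable f →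
      Integrable (fun ξ => f (stretch a (e1 d) (Φ.rot j l ξ))) := fun ha hf =>
    ((Φ.rot j l).measurePreserving.integrable_comp_emb
      (Φ.rot j l).toMeasurableEquiv.measurableEmbedding).2 (integrable_comp_stretch ha norm_e1 hf)
  have hwcont : Continuous (fun ξ => (Φ.win j l ξ : ℂ)) := by
    rw [hwin]
    exact hWc.continuous.comp
      ((LinearMap.continuous_of_finiteDimensional _).comp (Φ.rot j l).continuous)
  have hwint : Integrable (fun ξ => (Φ.win j l ξ : ℂ)) := by
    rw [hwin]
    exact hpull (by positivity) hint
  have hFcont : Continuous (𝓕 (fun η => (Φ.normWin j l η : ℂ))) :=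
    VectorFourier.fourierIntegral_continuous Real.continuous_fourierChar continuous_inner hint
  have hFint : Integrable (𝓕 (fun η => (Φ.normWin j l η : ℂ))) := by
    obtain ⟨C, -, hC⟩ := exists_norm_fourier_le (Eucl d) 5 n
    have := hC _ B hWc (fun x hx => hsupp (by simpa using hx)) (fun i hi x => by
      have h2 := Complex.ofRealLI.norm_iteratedFDeriv_comp_left (f := Φ.normWin j l) (x := x)
        hW.contDiffAt (i := i) (by exact_mod_cast hi)
      exact h2.le.trans (hB i hi x))
    exact ((integrable_inv_one_add_norm_sq_pow (by simpa using hn)).const_mul (C * B)).mono'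
      hFcont.aestronglyMeasurable (Eventually.of_forall this)
  have hwFint : Integrable (𝓕 (fun ξ => (Φ.win j l ξ : ℂ))) := by
    have : 𝓕 (fun ξ => (Φ.win j l ξ : ℂ)) = fun w =>
        (2 ^ j : ℝ) • 𝓕 (fun η => (Φ.normWin j l η : ℂ))
          (stretch (2 ^ j) (e1 d) (Φ.rot j l w)) := by
      funext w
      rw [fourier_win_eq, Uinv_eq]
    rw [this]
    exact (hpull (a := 2 ^ j) (by positivity) hFint).smul (2 ^ j : ℝ)
  have hpsi : 𝓕 (Φ.psi j l) ξ = Φ.win j l ξ :=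
    congr_fun (hwcont.fourier_fourierInv_eq hwint hwFint) ξ
  set q := Φ.U j l (latticePt k)
  rw [← hpsi, Real.fourier_eq, Real.fourier_eq,
    ← integral_sub_right_eq_self (fun x => Real.fourierChar (-⟪x, ξ⟫) • Φ.psi j l x) q,
    ← integral_const_mul, ← integral_const_mul]
  refine integral_congr_ae (Eventually.of_forall fun x => ?_)
  have : -⟪x, ξ⟫ = -⟪ξ, q⟫ + -⟪x - q, ξ⟫ := by
    rw [inner_sub_left, real_inner_comm ξ q]
    ring
  simp only [ridgelet, this, AddChar.map_add_eq_mul, Circle.smul_def, Circle.coe_mul, smul_eq_mul]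
  ring

/-- On a polar rectangle, the symbol `(ξ · n) / |ξ|²` is `2^{-j}` times a function that is
smooth in the transformed variable `η = U^⊤ ξ`, uniformly in the scale. -/
lemma win_mul_symbol {V : Eucl d → Eucl d}
    (hV : ∀ x, 1 / 2 < ‖x‖ → ‖x‖ < 2 → V x = (‖x‖ ^ 2)⁻¹ • x)
    (hs : Function.support (Φ.win j l) ⊆ polarRect (Φ.dir j l) j) (n ξ : Eucl d) :
    Φ.win j l ξ * (⟪ξ, n⟫ / ‖ξ‖ ^ 2) = (2 ^ j)⁻¹ *
      (Φ.normWin j l (stretch ((2 ^ j)⁻¹) (e1 d) (Φ.rot j l ξ)) *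
        ⟪Φ.rot j l n, V (((2 : ℝ) ^ j)⁻¹ •
          stretch (2 ^ j) (e1 d) (stretch ((2 ^ j)⁻¹) (e1 d) (Φ.rot j l ξ)))⟫) := by
  rw [← win_eq_normWin]
  by_cases h0 : Φ.win j l ξ = 0
  · simp [h0]
  obtain ⟨h1, h2, -⟩ := mem_polarRect_iff.1 (hs h0)
  set T : ℝ := 2 ^ j
  have hT : 0 < T := by positivity
  have hξ : ‖ξ‖ ≠ 0 := (lt_trans (by positivity) h1).ne'
  rw [stretch_stretch norm_e1, mul_inv_cancel₀ hT.ne', stretch_one]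
  have hn : ‖T⁻¹ • Φ.rot j l ξ‖ = ‖ξ‖ / T := by
    rw [norm_smul, LinearIsometryEquiv.norm_map, Real.norm_eq_abs, abs_of_pos (inv_pos.2 hT)]
    ring
  rw [hV, hn, inner_smul_right, inner_smul_right, LinearIsometryEquiv.inner_map_map,
    real_inner_comm]
  · field_simp
  · rw [hn, lt_div_iff₀ hT]; linarith
  · rw [hn, div_lt_iff₀ hT]; exact h2

end System

end Frequency

/-! ### The singular contribution -/

lemma fourier_modulation {E : Type*} [NormedAddCommGroup E] [InnerProductSpace ℝ E]
    [FiniteDimensional ℝ E] [MeasurableSpace E] [BorelSpace E] (f : E → ℂ) (q w : E) :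
    𝓕 (fun ξ => (Real.fourierChar ⟪ξ, q⟫ : ℂ) * f ξ) w = 𝓕 f (w - q) := by
  rw [Real.fourier_eq, Real.fourier_eq]
  refine integral_congr_ae (Eventually.of_forall fun ξ => ?_)
  have : -⟪ξ, w - q⟫ = -⟪ξ, w⟫ + ⟪ξ, q⟫ := by
    rw [inner_sub_right]
    ring
  simp only [this, AddChar.map_add_eq_mul, Circle.smul_def, Circle.coe_mul, smul_eq_mul]
  ring

namespace System

variable {d : ℕ} [NeZero d] {Φ : System d} {j : ℕ} {l : Fin (Φ.L j + 1)}

lemma singularCoeff_eq {n : ℕ} (hn : d < 2 * n)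
    (hW : ContDiff ℝ (2 * n : ℕ) (Φ.normWin j l)) {B : ℝ}
    (hB : ∀ i ≤ 2 * n, ∀ η, ‖iteratedFDeriv ℝ i (Φ.normWin j l) η‖ ≤ B)
    (hs : Function.support (Φ.win j l) ⊆ polarRect (Φ.dir j l) j) (h : Hyperplane d)
    (γ : Lp ℂ 2 (volume : Measure (Eucl (d - 1)))) (k : Fin d → ℤ) :
    Φ.singularCoeff h γ j l k = (((2 : ℝ) ^ (-(j : ℝ) / 2) : ℝ) * -(Complex.I / (2 * Real.pi))) *
      ∫ ξ, ((Real.fourierChar ⟪ξ, Φ.U j l (latticePt k) - h.v • h.n⟫ : ℂ) *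
        ((Φ.win j l ξ * (⟪ξ, h.n⟫ / ‖ξ‖ ^ 2) : ℝ) : ℂ)) *
        (𝓕 γ : Lp ℂ 2 (volume : Measure (Eucl (d - 1))))
          (ContinuousLinearMap.adjoint h.J.toContinuousLinearMap ξ) := by
  rw [singularCoeff, ← integral_const_mul]
  refine integral_congr_ae (Eventually.of_forall fun ξ => ?_)
  set q := Φ.U j l (latticePt k) with hq
  have h1 : (Real.fourierChar ⟪ξ, q - h.v • h.n⟫ : ℂ) = (starRingEnd ℂ)
      (Real.fourierChar (-⟪ξ, q⟫) : ℂ) *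
      Complex.exp (-(2 * Real.pi * (h.v * ⟪ξ, h.n⟫) : ℝ) * Complex.I) := by
    rw [inner_sub_right, inner_smul_right, sub_eq_add_neg, AddChar.map_add_eq_mul, Circle.coe_mul,
      ← Circle.coe_inv_eq_conj, ← AddChar.map_neg_eq_inv, neg_neg,
      Real.fourierChar_apply (-(h.v * ⟪ξ, h.n⟫))]
    congr 2
    push_cast
    ring
  simp only [fourier_ridgelet hn hW hB hs, ← hq, h1, Hyperplane.singularFourier,
    Hyperplane.layerFourier, map_mul, Complex.conj_ofReal]
  push_cast
  ring

/-- The decay of the density `γ` and of the kernel against which it is integrated give the bound for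
the singular contribution. -/
lemma exists_norm_singularCoeff_le (m : ℕ) (hΦ : Φ.SmoothUpTo (2 * (m + d))) :
    ∃ C : ℝ, 0 ≤ C ∧ ∀ (h : Hyperplane d) (γ : Lp ℂ 2 (volume : Measure (Eucl (d - 1)))) (A : ℝ),
      0 ≤ A → (∀ᵐ y, ‖γ y‖ ≤ A / bracket y ^ (2 * m)) →
      ∀ (j : ℕ) (l : Fin (Φ.L j + 1)) (k : Fin d → ℤ),
      Function.support (Φ.win j l) ⊆ polarRect (Φ.dir j l) j →
      ∀ (φ : ℝ) (b : Eucl d), Φ.IsAngle h.n j l φ b →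
      ‖Φ.singularCoeff h γ j l k‖ ≤
        C * A * locBound m j φ b (Φ.shift h j l k) ((2 : ℝ) ^ (-(j : ℝ) / 2)) := by
  have hd : 1 ≤ d := NeZero.one_le
  obtain ⟨hsmooth, B, hB⟩ := hΦ
  obtain ⟨V, hV, hVc, hVinv⟩ := exists_smooth_inversion (Eucl d)
  obtain ⟨C₁, hC₁, hsymb⟩ := exists_bound_mul_inner (Eucl d) hV hVc (2 * (m + d))
  obtain ⟨C₂, hC₂, hdecay⟩ := exists_norm_fourier_le (Eucl d) 5 (m + d)
  have hB0 : 0 ≤ B := (norm_nonneg _).trans (hB 0 (Nat.zero_le _) 0 0 0)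
  set I : ℝ := ∫ x : Eucl (d - 1), ((1 + ‖x‖ ^ 2) ^ d)⁻¹
  have hI : Integrable (fun x : Eucl (d - 1) => ((1 + ‖x‖ ^ 2) ^ d)⁻¹) :=
    integrable_inv_one_add_norm_sq_pow (by simp; omega)
  have hI0 : 0 ≤ I := integral_nonneg fun x => by positivity
  refine ⟨C₂ * (C₁ * B) * 2 ^ m * I, by positivity, ?_⟩
  intro h γ A hA hγ j l k hs φ b ⟨hb, heb, hang⟩
  set T : ℝ := 2 ^ j with hT
  have hT1 : 1 ≤ T := one_le_pow₀ (by norm_num)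
  have hT0 : 0 < T := by positivity
  set R := Φ.rot j l with hR
  set t := Φ.shift h j l k with ht
  -- the symbol in the transformed variable
  let D : Eucl d →L[ℝ] Eucl d := T⁻¹ • (stretch T (e1 d)).toContinuousLinearMap
  have hD : ‖D‖ ≤ 1 := by
    refine ContinuousLinearMap.opNorm_le_bound _ zero_le_one fun x => ?_
    change ‖T⁻¹ • stretch T (e1 d) x‖ ≤ _
    rw [norm_smul, Real.norm_eq_abs, abs_of_pos (inv_pos.2 hT0), one_mul, inv_mul_le_iff₀ hT0]
    exact norm_stretch_le norm_e1 hT1 x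
  obtain ⟨hPs, hPb⟩ := hsymb (Φ.normWin j l) B (hsmooth j l) (fun i hi => hB i hi j l) D hD
    (R h.n) (by rw [R.norm_map, h.norm_n])
  set P : Eucl d → ℂ := fun η => ((Φ.normWin j l η * ⟪R h.n, V (D η)⟫ : ℝ) : ℂ) with hP
  have hPsupp : Function.support P ⊆ Metric.closedBall 0 5 := by
    intro η hη
    refine support_normWin_subset hs fun h0 => hη ?_
    simp [hP, h0]
  have hPdecay := hdecay P (C₁ * B) hPs hPsupp hPb
  set M : Eucl d → ℂ := fun ξ =>
    (Real.fourierChar ⟪ξ, Φ.U j l (latticePt k) - h.v • h.n⟫ : ℂ) *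
      ((Φ.win j l ξ * (⟪ξ, h.n⟫ / ‖ξ‖ ^ 2) : ℝ) : ℂ) with hM
  have hsym : ∀ ξ, ((Φ.win j l ξ * (⟪ξ, h.n⟫ / ‖ξ‖ ^ 2) : ℝ) : ℂ) =
      ((T⁻¹ : ℝ) : ℂ) * P (stretch T⁻¹ (e1 d) (R ξ)) := by
    intro ξ
    rw [win_mul_symbol hVinv hs, Complex.ofReal_mul]
    rfl
  have hMcont : Continuous M := by
    simp only [hM, hsym]
    refine Continuous.mul (by fun_prop) (continuous_const.mul (hPs.continuous.comp ?_))
    exact (LinearMap.continuous_of_finiteDimensional _).comp R.continuous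
  have hMc : HasCompactSupport M := by
    refine HasCompactSupport.intro (isCompact_closedBall 0 (2 * T)) fun ξ hξ => ?_
    have : Φ.win j l ξ = 0 := by
      by_contra h0
      exact hξ (by simpa using (mem_polarRect_iff.1 (hs h0)).2.1.le)
    simp [hM, this]
  -- the kernel
  have hFM : ∀ y, 𝓕 M (h.J y) = 𝓕 P (stretch T (e1 d) (R (h.J y)) - t) := by
    intro y
    rw [hM, fourier_modulation]
    simp only [hsym]
    have h1 : ∀ w, 𝓕 (fun ξ => ((T⁻¹ : ℝ) : ℂ) * P (stretch T⁻¹ (e1 d) (R ξ))) w =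
        𝓕 P (stretch T (e1 d) (R w)) := by
      intro w
      have h2 : 𝓕 (fun ξ => ((T⁻¹ : ℝ) : ℂ) * P (stretch T⁻¹ (e1 d) (R ξ))) w =
          ((T⁻¹ : ℝ) : ℂ) * 𝓕 (fun ξ => P (stretch T⁻¹ (e1 d) (R ξ))) w := by
        rw [Real.fourier_eq, Real.fourier_eq, ← integral_const_mul]
        refine integral_congr_ae (Eventually.of_forall fun ξ => ?_)
        simp only [Circle.smul_def, smul_eq_mul]
        ring
      rw [h2, fourier_comp_stretch R P hT0 norm_e1, Complex.real_smul, ← mul_assoc,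
        ← Complex.ofReal_mul, inv_mul_cancel₀ hT0.ne', Complex.ofReal_one, one_mul]
    rw [h1, ht, shift, U_eq, Uinv_eq]
    simp only [map_sub, map_smul, LinearIsometryEquiv.apply_symm_apply, ← hR, ← hT]
    rw [stretch_stretch norm_e1, mul_inv_cancel₀ hT0.ne', stretch_one]
  obtain ⟨c, y₀, hc, hgeo⟩ := exists_stretch_hyperplane (R.toLinearIsometry.comp h.J)
    norm_e1 hb heb j φ
    (fun y => by
      rw [← hang]
      exact (R.inner_map_map _ _).trans (h.orth y))
    (fun x hx => by
      rw [← hang] at hx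
      have hx' : ⟪R.symm x, h.n⟫ = 0 := by
        rw [← R.inner_map_map, R.apply_symm_apply]
        exact hx
      refine ⟨ContinuousLinearMap.adjoint h.J.toContinuousLinearMap (R.symm x), ?_⟩
      change R (h.J _) = x
      rw [h.J_adjoint_apply hd hx', R.apply_symm_apply]) t
  change ∀ y, ‖stretch T (e1 d) (R (h.J y)) - t‖ ^ 2 = _ ∧
    _ ≤ 2 * (1 + ‖y‖ ^ 2) * (1 + ‖stretch T (e1 d) (R (h.J y)) - t‖ ^ 2) at hgeo
  rw [inner_e1] at hgeo
  set a := aniso j φ with ha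
  have ha0 : 0 < a := zero_lt_one.trans_le (one_le_aniso j φ)
  set Q := ‖t - t 0 • e1 d - ⟪b, t⟫ • b‖ ^ 2 + rho1 j φ (t 0) ⟪b, t⟫ ^ 2
      + rho2 j φ (t 0) ⟪b, t⟫ ^ 2 + 1 with hQ
  have hQ0 : 0 < Q := by positivity
  let G : Eucl (d - 1) → ℝ := fun y => ((1 + ‖stretch a c y - y₀‖ ^ 2) ^ d)⁻¹
  have hG0 : ∀ y, 0 ≤ G y := fun y => by positivity
  have hG : Integrable G := integrable_comp_stretch ha0.ne' hc (hI.comp_sub_right y₀)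
  have hGI : ∫ y, G y = a⁻¹ * I := by
    have := integral_comp_stretch ha0.ne' hc (fun x => ((1 + ‖x - y₀‖ ^ 2) ^ d)⁻¹)
    rw [integral_sub_right_eq_self (fun x : Eucl (d - 1) => ((1 + ‖x‖ ^ 2) ^ d)⁻¹) y₀,
      abs_of_pos (inv_pos.2 ha0)] at this
    exact this
  have hzle : ∀ y, 1 + ‖stretch a c y - y₀‖ ^ 2 ≤
      1 + ‖stretch T (e1 d) (R (h.J y)) - t‖ ^ 2 := fun y => by
    rw [(hgeo y).1]
    linarith [sq_nonneg (rho1 j φ (t 0) ⟪b, t⟫)]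
  have hker : ∀ y, ‖𝓕 M (h.J y)‖ ≤ C₂ * (C₁ * B) *
      (((1 + ‖stretch T (e1 d) (R (h.J y)) - t‖ ^ 2) ^ m)⁻¹ * G y) := by
    intro y
    rw [hFM]
    refine (hPdecay _).trans ?_
    rw [pow_add, mul_inv]
    refine mul_le_mul_of_nonneg_left (mul_le_mul_of_nonneg_left ?_ (by positivity))
      (by positivity)
    exact inv_anti₀ (by positivity) (pow_le_pow_left₀ (by positivity) (hzle y) d)
  have hker' : ∀ y, ‖𝓕 M (h.J y)‖ ≤ C₂ * (C₁ * B) * G y := by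
    intro y
    refine (hker y).trans ?_
    refine mul_le_mul_of_nonneg_left ?_ (by positivity)
    refine mul_le_of_le_one_left (hG0 y) (inv_le_one_of_one_le₀ (one_le_pow₀ ?_))
    linarith [sq_nonneg ‖stretch T (e1 d) (R (h.J y)) - t‖]
  have hFMcont : Continuous (fun y => 𝓕 M (h.J y)) :=
    (VectorFourier.fourierIntegral_continuous Real.continuous_fourierChar continuous_inner
      (hMcont.integrable_of_hasCompactSupport hMc)).comp h.J.continuous
  have hM2 : MemLp (fun y => 𝓕 M (h.J y)) 2 := by
    rw [memLp_two_iff_integrable_sq_norm hFMcont.aestronglyMeasurable]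
    refine (hG.const_mul ((C₂ * (C₁ * B)) ^ 2)).mono'
      (hFMcont.norm.pow 2).aestronglyMeasurable (Eventually.of_forall fun y => ?_)
    rw [Real.norm_of_nonneg (sq_nonneg _)]
    have hG1 : G y ≤ 1 := inv_le_one_of_one_le₀ (one_le_pow₀ (by
      linarith [sq_nonneg ‖stretch a c y - y₀‖]))
    calc _ ≤ (C₂ * (C₁ * B) * G y) ^ 2 := pow_le_pow_left₀ (norm_nonneg _) (hker' y) 2
      _ = (C₂ * (C₁ * B)) ^ 2 * (G y * G y) := by ring
      _ ≤ _ := by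
        refine mul_le_mul_of_nonneg_left ?_ (sq_nonneg _)
        exact mul_le_of_le_one_left (hG0 y) hG1
  have hbr : ∀ y : Eucl (d - 1), bracket y ^ (2 * m) = (1 + ‖y‖ ^ 2) ^ m := fun y => by
    rw [bracket, pow_mul, Real.sq_sqrt (by positivity)]
  -- Peetre's inequality moves the decay of `γ` to the parameters of the bound
  have hint : ‖∫ y, 𝓕 M (h.J y) * γ y‖ ≤
      ∫ y, C₂ * (C₁ * B) * A * 2 ^ m * (Q ^ m)⁻¹ * G y := by
    refine norm_integral_le_of_norm_le (hG.const_mul _) ?_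
    filter_upwards [hγ] with y hy
    rw [hbr] at hy
    set Z := 1 + ‖stretch T (e1 d) (R (h.J y)) - t‖ ^ 2 with hZ
    set Y := 1 + ‖y‖ ^ 2 with hY
    have hZ0 : 0 < Z := by positivity
    have hY0 : 0 < Y := by positivity
    have hpeetre : (Z ^ m)⁻¹ * (Y ^ m)⁻¹ ≤ 2 ^ m * (Q ^ m)⁻¹ := by
      rw [← mul_inv, ← mul_pow, ← div_eq_mul_inv, ← div_pow, ← inv_pow]
      refine pow_le_pow_left₀ (by positivity) ?_ m
      rw [inv_le_iff_one_le_mul₀ (by positivity), div_mul_eq_mul_div, one_le_div hQ0]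
      calc Q ≤ 2 * Y * Z := (hgeo y).2
        _ = _ := by ring
    rw [norm_mul]
    calc _ ≤ C₂ * (C₁ * B) * ((Z ^ m)⁻¹ * G y) * (A / Y ^ m) :=
          mul_le_mul (hker y) hy (norm_nonneg _) (by have := hG0 y; positivity)
      _ = C₂ * (C₁ * B) * A * ((Z ^ m)⁻¹ * (Y ^ m)⁻¹) * G y := by ring
      _ ≤ C₂ * (C₁ * B) * A * (2 ^ m * (Q ^ m)⁻¹) * G y := by
        refine mul_le_mul_of_nonneg_right ?_ (hG0 y)
        exact mul_le_mul_of_nonneg_left hpeetre (by positivity)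
      _ = _ := by ring
  rw [integral_const_mul, hGI] at hint
  have hpi : ‖(-(Complex.I / (2 * Real.pi)) : ℂ)‖ ≤ 1 := by
    rw [norm_neg, norm_div, Complex.norm_I, norm_mul, Complex.norm_real,
      Real.norm_of_nonneg Real.pi_pos.le, Complex.norm_ofNat]
    rw [div_le_one (by positivity)]
    linarith [Real.pi_gt_three]
  rw [singularCoeff_eq (n := m + d) (by omega) (hsmooth j l) (fun i hi => hB i hi j l) hs h γ k,
    h.integral_mul_fourier_layer hd hMcont hMc hM2, norm_mul, norm_mul, Complex.norm_real,
    Real.norm_of_nonneg (by positivity), locBound, ← hQ, ← ha]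
  calc _ ≤ (2 : ℝ) ^ (-(j : ℝ) / 2) * 1 *
        (C₂ * (C₁ * B) * A * 2 ^ m * (Q ^ m)⁻¹ * (a⁻¹ * I)) := by gcongr
    _ = _ := by
      rw [one_div, div_eq_mul_inv]
      ring

lemma weight_le {s : Eucl d} (hs : ‖s‖ = 1) : Φ.weight s j l ≤ 2 * 2 ^ j := by
  have h1 : |⟪s, Φ.dir j l⟫| ≤ 1 := by
    have := abs_real_inner_le_norm s (Φ.dir j l)
    rwa [hs, Φ.norm_dir, mul_one] at this
  have h2 : (1 : ℝ) ≤ 2 ^ j := one_le_pow₀ (by norm_num)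
  have h3 : (2 : ℝ) ^ j * |⟪s, Φ.dir j l⟫| ≤ 2 ^ j := mul_le_of_le_one_right (by positivity) h1
  rw [weight]
  linarith

end System

lemma locBound_nonneg {d : ℕ} [NeZero d] (m j : ℕ) (φ : ℝ) (b t : Eucl d) {q : ℝ} (hq : 0 ≤ q) :
    0 ≤ locBound m j φ b t q := by
  unfold locBound aniso
  positivity

lemma locBound_const_mul {d : ℕ} [NeZero d] (m j : ℕ) (φ : ℝ) (b t : Eucl d) (x q : ℝ) :
    locBound m j φ b t (x * q) = x * locBound m j φ b t q := by
  unfold locBound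
  ring

lemma nonneg_of_ae_norm_le_div_bracket {d m : ℕ} {f : Eucl d → ℂ} {A : ℝ}
    (hf : ∀ᵐ y, ‖f y‖ ≤ A / bracket y ^ (2 * m)) : 0 ≤ A := by
  obtain ⟨y, hy⟩ := hf.exists
  have hb : 0 < bracket y ^ (2 * m) := by
    unfold bracket
    positivity
  have := (le_div_iff₀ hb).1 ((norm_nonneg _).trans hy)
  rwa [zero_mul] at this

end Ridgelet

end

theorem proposition4p5 (d : ℕ) [NeZero d] (hd : 2 ≤ d) (m : ℕ) :
    -- the required smoothness of the windows depends only on `d` and `m`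
    ∃ N : ℕ, ∀ Φ : Ridgelet.System d, Φ.SmoothUpTo N →
    ∃ C : ℝ, 0 < C ∧
      ∀ (h : Ridgelet.Hyperplane d) (g : Lp ℂ 2 (volume : Measure (Ridgelet.Eucl d))),
      TemperedDistribution.MemSobolev (1 / 2) 2 (g : 𝓢'(Ridgelet.Eucl d, ℂ)) →
      -- the coefficients of `f = H(x · n - v) g`
      (∀ (γ : Lp ℂ 2 (volume : Measure (Ridgelet.Eucl (d - 1)))) (A : ℝ),
        h.HasTrace g γ →
        (∀ᵐ y, ‖γ y‖ ≤ A / Ridgelet.bracket y ^ (2 * m)) →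
        ∀ (j : ℕ) (l : Fin (Φ.L j + 1)) (k : Fin d → ℤ),
          Function.support (Φ.win j l) ⊆ Ridgelet.polarRect (Φ.dir j l) j →
          ∀ (φ : ℝ) (b : Ridgelet.Eucl d), Φ.IsAngle h.n j l φ b →
          ‖Φ.singularCoeff h γ j l k‖ ≤
            C * A * Ridgelet.locBound m j φ b (Φ.shift h j l k) ((2 : ℝ) ^ (-(j : ℝ) / 2))) ∧
      -- the weighted coefficients of the solution `u = u₀ + H(x · n - v) u₁`
      (∀ (κ : Ridgelet.Eucl d → ℝ) (κ₀ : ℝ) (s : Ridgelet.Eucl d)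
        (R : Ridgelet.Eucl d ≃ₗᵢ[ℝ] Ridgelet.Eucl d)
        (u₀ u₁ : Lp ℂ 2 (volume : Measure (Ridgelet.Eucl d)))
        (γ : Lp ℂ 2 (volume : Measure (Ridgelet.Eucl (d - 1)))) (A : ℝ),
        LocallyIntegrable κ → 0 < κ₀ → (∀ᵐ x, κ₀ ≤ κ x) →
        ‖s‖ = 1 → R s = Ridgelet.e1 d →
        TemperedDistribution.MemSobolev (1 / 2) 2 (u₀ : 𝓢'(Ridgelet.Eucl d, ℂ)) →
        TemperedDistribution.MemSobolev (1 / 2) 2 (u₁ : 𝓢'(Ridgelet.Eucl d, ℂ)) →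
        (∀ᵐ x, Ridgelet.solution κ R (h.cut g) x = u₀ x + h.cut u₁ x) →
        h.HasTrace u₁ γ →
        (∀ᵐ y, ‖γ y‖ ≤ A / Ridgelet.bracket y ^ (2 * m)) →
        ∀ (j : ℕ) (l : Fin (Φ.L j + 1)) (k : Fin d → ℤ),
          Function.support (Φ.win j l) ⊆ Ridgelet.polarRect (Φ.dir j l) j →
          ∀ (φ : ℝ) (b : Ridgelet.Eucl d), Φ.IsAngle h.n j l φ b →
          ‖(Φ.weight s j l : ℂ) * Φ.singularCoeff h γ j l k‖ ≤
            C * A * Ridgelet.locBound m j φ b (Φ.shift h j l k) ((2 : ℝ) ^ ((j : ℝ) / 2))) := by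
  refine ⟨2 * (m + d), fun Φ hΦ => ?_⟩
  obtain ⟨C, hC0, hC⟩ := Ridgelet.System.exists_norm_singularCoeff_le m hΦ
  refine ⟨2 * C + 1, by positivity, fun h g _ => ⟨?_, ?_⟩⟩
  · intro γ A _ hγ j l k hs φ b hφ
    have hA := Ridgelet.nonneg_of_ae_norm_le_div_bracket hγ
    refine (hC h γ A hA hγ j l k hs φ b hφ).trans ?_
    have hl := Ridgelet.locBound_nonneg m j φ b (Φ.shift h j l k)
      (Real.rpow_nonneg two_pos.le (-(j : ℝ) / 2))
    refine mul_le_mul_of_nonneg_right ?_ hl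
    exact mul_le_mul_of_nonneg_right (by linarith) hA
  · intro κ κ₀ s R u₀ u₁ γ A _ _ _ hs1 _ _ _ _ _ hγ j l k hs φ b hφ
    have hA := Ridgelet.nonneg_of_ae_norm_le_div_bracket hγ
    have hw : ‖(Φ.weight s j l : ℂ)‖ ≤ 2 * 2 ^ j := by
      rw [Complex.norm_real, Real.norm_of_nonneg (by unfold Ridgelet.System.weight; positivity)]
      exact Ridgelet.System.weight_le hs1
    -- the weight is at most of the size `2^j`, and `2^j 2^{-j/2} = 2^{j/2}`
    have hq : (2 : ℝ) ^ ((j : ℝ) / 2) = 2 ^ j * 2 ^ (-(j : ℝ) / 2) := by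
      rw [← Real.rpow_natCast, ← Real.rpow_add two_pos]
      congr 1
      ring
    have hl := Ridgelet.locBound_nonneg m j φ b (Φ.shift h j l k)
      (Real.rpow_nonneg two_pos.le (-(j : ℝ) / 2))
    rw [hq, Ridgelet.locBound_const_mul, norm_mul]
    set X := Ridgelet.locBound m j φ b (Φ.shift h j l k) ((2 : ℝ) ^ (-(j : ℝ) / 2))
    calc _ ≤ 2 * 2 ^ j * (C * A * X) :=
          mul_le_mul hw (hC h γ A hA hγ j l k hs φ b hφ) (norm_nonneg _) (by positivity)
      _ = 2 * C * (A * (2 ^ j * X)) := by ring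
      _ ≤ (2 * C + 1) * (A * (2 ^ j * X)) :=
          mul_le_mul_of_nonneg_right (by linarith) (by positivity)
      _ = _ := by ring
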